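/- Let $\mathcal N$ be the set of isomorphism classes of number fields. For a number field $K$, let $\zeta_K(z)$ be its Dedekind zeta function, i.e. the meromorphic continuation to $\mathbb C$ of the series $\sum_{\mathfrak a} \mathrm N(\mathfrak a)^{-z}$ ($\mathrm{Re}(z)>1$) over the nonzero ideals $\mathfrak a$ of the ring of integers of $K$. For $s\in\mathbb C$ let $$\zeta_K^*(s) := \lim_{z\to s}\frac{\zeta_K(z)}{(z-s)^{\mathrm{ord}_{z=s}\zeta_K(z)}}$$ be its special value at $s$, i.e. the first non-vanishing coefficient of the Laurent expansion of $\zeta_K$ at $s$. **Theorem.** Let $s$ be a complex number with $\mathrm{Re}(s)<0$. Then the function $[K]\mapsto\left(|\zeta_K^*(s)|,\,[K:\mathbb Q]\right)$ on $\mathcal N$ has the Northcott property: for every real $B$ and every natural number $D$, the set $$\left\{[K]\in\mathcal N \;:\; |\zeta_K^*(s)|\le B \text{ and } [K:\mathbb Q]\le D\right\}$$ is finite. -/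

import Mathlib

universe u

noncomputable section

/-- A number field, bundled as an object. -/
structure BundledNumberField : Type (u + 1) where
  carrier : Type u
  [field : Field carrier]
  [numberField : NumberField carrier]

attribute [instance] BundledNumberField.field BundledNumberField.numberField

/-- Two number fields are identified when they are isomorphic as fields. -/
instance numberFieldSetoid : Setoid BundledNumberField.{u} where
  r K L := Nonempty (K.carrier ≃+* L.carrier)
  iseqv :=
    { refl := fun K => ⟨RingEquiv.refl K.carrier⟩
      symm := fun ⟨e⟩ => ⟨e.symm⟩
      trans := fun ⟨e⟩ ⟨f⟩ => ⟨e.trans f⟩ }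

/-- The isomorphism classes of number fields. -/
def NumberFieldClass : Type (u + 1) :=
  Quotient numberFieldSetoid.{u}

open Classical in
/-- A meromorphic continuation to `ℂ` of a function `Z` given on the half-plane `1 < re z`.
Any two continuations agree outside a discrete set, so orders and Laurent coefficients at a point
do not depend on the choice. (If there is no continuation, the value is the zero function.) -/
def meromorphicContinuation (Z : ℂ → ℂ) : ℂ → ℂ :=
  if h : ∃ f : ℂ → ℂ, Meromorphic f ∧ ∀ z : ℂ, 1 < z.re → f z = Z z then h.choose else 0

/-- The Dedekind zeta function of `K` as a meromorphic function on `ℂ`: the continuation of the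
Dirichlet series `∑ N(𝔞)^(-z)` over the nonzero ideals of `𝓞 K`, which converges for
`1 < re z`. -/
def dedekindZetaMero (K : Type u) [Field K] [NumberField K] : ℂ → ℂ :=
  meromorphicContinuation (NumberField.dedekindZeta K)

/-- The special value `ζ_K^*(s)`: the first nonzero coefficient of the Laurent expansion of `ζ_K`
at `s`, i.e. the limit of `ζ_K(z) / (z - s) ^ ord_s(ζ_K)` as `z → s`. -/
def dedekindSpecialValue (K : Type u) [Field K] [NumberField K] (s : ℂ) : ℂ :=
  meromorphicTrailingCoeffAt (dedekindZetaMero K) s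

/-- Isomorphic number fields have the same Dedekind series. -/
theorem dedekindZeta_congr {K L : Type u} [Field K] [NumberField K] [Field L] [NumberField L]
    (e : K ≃+* L) : NumberField.dedekindZeta K = NumberField.dedekindZeta L := by
  let e' : NumberField.RingOfIntegers K ≃+* NumberField.RingOfIntegers L :=
    NumberField.RingOfIntegers.mapRingEquiv e
  have key : ∀ I : Ideal (NumberField.RingOfIntegers L),
      Ideal.absNorm (Ideal.comap e' I) = Ideal.absNorm I := by
    intro I
    rw [Ideal.absNorm_apply, Ideal.absNorm_apply, Submodule.cardQuot_apply,
      Submodule.cardQuot_apply]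
    exact Nat.card_congr (Ideal.quotientEquiv (Ideal.comap e' I) I e'
      (Ideal.map_comap_of_surjective _ e'.surjective I).symm).toEquiv
  funext s
  unfold NumberField.dedekindZeta
  congr 1
  funext n
  congr 1
  refine (Nat.card_congr (Equiv.subtypeEquiv e'.idealComapOrderIso.toEquiv ?_)).symm
  intro I
  change _ ↔ Ideal.absNorm (Ideal.comap e' I) = n
  rw [key]

/-- The Dedekind height `h_s([K]) = |ζ_K^*(s)|` on isomorphism classes of number fields. -/
def dedekindHeight (s : ℂ) : NumberFieldClass.{u} → ℝ :=
  Quotient.lift (fun K : BundledNumberField.{u} => ‖dedekindSpecialValue K.carrier s‖) (by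
    rintro K L ⟨e⟩
    simp only [dedekindSpecialValue, dedekindZetaMero, dedekindZeta_congr e])

/-- The degree `[K : ℚ]` on isomorphism classes of number fields. -/
def numberFieldDegree : NumberFieldClass.{u} → ℕ :=
  Quotient.lift (fun K : BundledNumberField.{u} => Module.finrank ℚ K.carrier) (by
    rintro K L ⟨e⟩
    exact (AlgEquiv.ofRingEquiv (f := e) (by simp)).toLinearEquiv.finrank_eq)

end

/-!
For `re s < 0` the functional equation moves the question to `1 - s`, where the Dedekind series
converges absolutely:
`|ζ_K^*(s)| = |d_K|^(1/2 - re s) · |γ^*(s)| · |ζ_K(1 - s)|`, where `d_K` is the discriminant of `K`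
and `γ` is a quotient of Gamma factors that depends only on the numbers of real and complex places
(`norm_dedekindSpecialValue`). A trailing coefficient of a meromorphic function that does not vanish
identically is nonzero, and a bounded degree leaves finitely many possible `γ`. The last factor is
bounded below in terms of the degree alone, since
`ζ_K(w) · ∏ (1 - N(𝔭)^(-w)) = 1` and at most `[K : ℚ]` primes lie above each rational prime
(`one_le_exp_mul_norm_dedekindZeta`). As the exponent of `|d_K|` is positive, a bound on the degree
and on the special value bounds the discriminant, and Hermite's theorem gives finiteness.

The analytic continuation and the functional equation are proved by Hecke's method. For a fractional
ideal `I` of `K` and positive weights `t` on the complex embeddings, Poisson summation relates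
the theta series of `I` at `t` to that of the trace dual of `I` at `t⁻¹` (`theta_inversion`).
Averaging the theta series over a fundamental domain of the unit lattice leaves a function of one
variable with a theta functional equation (`unitTheta_inv`); its Mellin transform is meromorphic and
satisfies a functional equation (`completedZeta_one_sub`). In the half-plane of convergence,
the integral over the fundamental domain unfolds to an integral over the whole logarithmic space,
which splits into Gamma integrals, one for each infinite place; hence the Mellin transform is a Gamma
factor times the sum of `N(J)^(-s)` over the integral ideals `J` in the class inverse to that of `I`
(`completedZeta_eq_tsum`). Passage to the trace dual permutes the ideal classes, so the sum over the
class group satisfies the functional equation of `ζ_K` (`continuedZeta_functional_equation`).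
-/

namespace DedekindNorthcott

open MeasureTheory Real Matrix

/-! ### Unfolding integrals over unit cubes -/

section Unfolding

variable {α E κ : Type*} [MeasurableSpace α] {μ : Measure α} [NormedAddCommGroup E]
  [NormedSpace ℝ E] [Fintype κ]

/-- Unfolding: if measure-preserving maps `τ k`, `k ∈ ℤ^κ`, translate real coordinates `p` by `k`,
then the integral over `α` is the sum of the integrals of the translates over the part of `α`
whose coordinates lie in the unit cube. -/
theorem hasSum_integral_unitCube {p : α → κ → ℝ} (hp : Measurable p) (τ : (κ → ℤ) → α ≃ᵐ α)
    (hτ : ∀ k, MeasurePreserving (τ k) μ μ) (hpτ : ∀ k a i, p (τ k a) i = p a i + k i)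
    {f : α → E} (hf : Integrable f μ) :
    HasSum (fun k => ∫ a in {a | ∀ i, p a i ∈ Set.Ioc (0 : ℝ) (0 + 1)}, f (τ k a) ∂μ)
      (∫ a, f a ∂μ) := by
  have hmeas : ∀ k : κ → ℤ, MeasurableSet {a | ∀ i, p a i ∈ Set.Ioc (k i : ℝ) (k i + 1)} := by
    intro k
    simp only [Set.ofPred_forall]
    exact MeasurableSet.iInter fun i => (measurable_pi_apply i).comp hp measurableSet_Ioc
  have hdisj : Pairwise (Function.onFun Disjoint
      fun k : κ → ℤ => {a | ∀ i, p a i ∈ Set.Ioc (k i : ℝ) (k i + 1)}) := by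
    intro k l hkl
    refine Set.disjoint_left.mpr fun a ha hb => hkl (funext fun i => ?_)
    have h1 := ha i
    have h2 := hb i
    rw [Set.mem_Ioc] at h1 h2
    have h3 : (k i : ℝ) < l i + 1 := by linarith
    have h4 : (l i : ℝ) < k i + 1 := by linarith
    norm_cast at h3 h4
    omega
  have hunion : (⋃ k : κ → ℤ, {a | ∀ i, p a i ∈ Set.Ioc (k i : ℝ) (k i + 1)}) = Set.univ := by
    refine Set.eq_univ_of_forall fun a => Set.mem_iUnion.mpr ⟨fun i => ⌈p a i⌉ - 1, fun i => ?_⟩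
    have h1 := Int.ceil_lt_add_one (p a i)
    have h2 := Int.le_ceil (p a i)
    push_cast
    constructor <;> linarith
  have key := hasSum_integral_iUnion hmeas hdisj (μ := μ) (f := f) (hf.integrableOn)
  rw [hunion, setIntegral_univ] at key
  refine key.congr_fun fun k => ?_
  rw [← (hτ k).setIntegral_preimage_emb (τ k).measurableEmbedding f]
  congr 2
  ext a
  simp only [Set.mem_preimage, Set.mem_ofPred_eq, hpτ, Set.mem_Ioc]
  refine forall_congr' fun i => ?_
  constructor <;> rintro ⟨h1, h2⟩ <;> constructor <;> linarith

end Unfolding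

/-! ### Summability and integrals of Gaussian functions -/

section Gaussian

variable {ι : Type*} [Fintype ι]

theorem summable_prod_pi {f : ℤ → ℝ} (hf0 : ∀ n, 0 ≤ f n) (hf : Summable f) :
    Summable fun m : ι → ℤ => ∏ i, f (m i) := by
  classical
  refine summable_of_sum_le (c := ∏ _i : ι, ∑' n, f n)
    (fun m => Finset.prod_nonneg fun i _ => hf0 _) fun u => ?_
  calc ∑ m ∈ u, ∏ i, f (m i)
      ≤ ∑ m ∈ Fintype.piFinset fun i => u.image fun m => m i, ∏ i, f (m i) := by
        refine Finset.sum_le_sum_of_subset_of_nonneg (fun m hm => ?_)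
          fun m _ _ => Finset.prod_nonneg fun i _ => hf0 _
        exact Fintype.mem_piFinset.mpr fun i => Finset.mem_image_of_mem _ hm
    _ = ∏ i, ∑ n ∈ u.image fun m => m i, f n := (Finset.prod_univ_sum _ _).symm
    _ ≤ ∏ _i : ι, ∑' n, f n :=
        Finset.prod_le_prod (fun i _ => Finset.sum_nonneg fun n _ => hf0 n)
          fun i _ => hf.sum_le_tsum _ fun n _ => hf0 n

theorem summable_exp_neg_sum_sq {a : ℝ} (ha : 0 < a) :
    Summable fun m : ι → ℤ => Real.exp (-a * ∑ i, (m i : ℝ) ^ 2) := by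
  have h1 : Summable fun n : ℤ => Real.exp (-a * (n : ℝ) ^ 2) := by
    have h := (summable_pow_mul_jacobiTheta₂_term_bound 0 (T := a / π) (by positivity) 0)
    refine h.congr fun n => ?_
    simp only [pow_zero, one_mul, mul_zero, zero_mul, sub_zero]
    congr 1
    field_simp
  refine (summable_prod_pi (fun n => (Real.exp_pos _).le) h1).congr fun m => ?_
  rw [← Real.exp_sum, Finset.mul_sum]

variable [DecidableEq ι]

/-- An invertible linear map is bounded below: the form `|S x|²` is coercive. -/
theorem exists_coercive {S : Matrix ι ι ℝ} (hS : S.det ≠ 0) :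
    ∃ δ > 0, ∀ x : ι → ℝ, δ * ∑ i, x i ^ 2 ≤ ∑ i, (S *ᵥ x) i ^ 2 := by
  set C := ∑ i, ∑ j, S⁻¹ i j ^ 2 with hC
  have hC0 : 0 ≤ C := Finset.sum_nonneg fun i _ => Finset.sum_nonneg fun j _ => sq_nonneg _
  refine ⟨(C + 1)⁻¹, by positivity, fun x => ?_⟩
  have hx : x = S⁻¹ *ᵥ (S *ᵥ x) := by
    rw [mulVec_mulVec, nonsing_inv_mul _ (isUnit_iff_ne_zero.mpr hS), one_mulVec]
  have hy0 : 0 ≤ ∑ i, (S *ᵥ x) i ^ 2 := Finset.sum_nonneg fun i _ => sq_nonneg _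
  have h : ∑ i, x i ^ 2 ≤ C * ∑ i, (S *ᵥ x) i ^ 2 := by
    rw [hC, Finset.sum_mul]
    refine Finset.sum_le_sum fun i _ => ?_
    conv_lhs => rw [hx]
    exact Finset.sum_mul_sq_le_sq_mul_sq _ _ _
  rw [inv_mul_le_iff₀ (by positivity)]
  linarith

theorem integrable_exp_neg_sum_sq_mulVec {S : Matrix ι ι ℝ} (hS : S.det ≠ 0) :
    Integrable fun x : ι → ℝ => Real.exp (-π * ∑ i, (S *ᵥ x) i ^ 2) := by
  obtain ⟨δ, hδ, h⟩ := exists_coercive hS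
  have h1 : Integrable fun x : ι → ℝ => ∏ i, Real.exp (-(π * δ) * x i ^ 2) :=
    Integrable.fintype_prod (f := fun _ x => Real.exp (-(π * δ) * x ^ 2))
      fun i => integrable_exp_neg_mul_sq (by positivity)
  refine h1.mono' ?_ (ae_of_all _ fun x => ?_)
  · refine Continuous.aestronglyMeasurable ?_
    have : Continuous fun x : ι → ℝ => S *ᵥ x := Continuous.matrix_mulVec continuous_const continuous_id
    fun_prop
  · rw [← Real.exp_sum, ← Finset.mul_sum, Real.norm_eq_abs, Real.abs_exp]
    have := mul_le_mul_of_nonneg_left (h x) pi_pos.le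
    exact Real.exp_le_exp.mpr (by linarith)

/-- The Fourier transform of a Gaussian `exp (-π |S x|²)`. -/
theorem integral_gaussian_mulVec {S : Matrix ι ι ℝ} (hS : S.det ≠ 0) (n : ι → ℝ) :
    ∫ x : ι → ℝ, Complex.exp (-π * ∑ i, ((S *ᵥ x) i : ℂ) ^ 2 - 2 * π * Complex.I * ∑ i, n i * x i)
      = |S.det|⁻¹ * Complex.exp (-π * ∑ i, (((S⁻¹)ᵀ *ᵥ n) i : ℂ) ^ 2) := by
  set g : (ι → ℝ) → ℂ := fun y => Complex.exp (-π * ∑ i, (y i : ℂ) ^ 2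
    + ∑ i, (-2 * π * Complex.I * (((S⁻¹)ᵀ *ᵥ n) i : ℝ)) * y i) with hg
  have h1 : ∀ x : ι → ℝ, Complex.exp (-π * ∑ i, ((S *ᵥ x) i : ℂ) ^ 2
      - 2 * π * Complex.I * ∑ i, n i * x i) = g (toLin' S x) := by
    intro x
    have h2 : ∑ i, ((S⁻¹)ᵀ *ᵥ n) i * (S *ᵥ x) i = ∑ i, n i * x i := by
      change ((S⁻¹)ᵀ *ᵥ n) ⬝ᵥ (S *ᵥ x) = n ⬝ᵥ x
      rw [mulVec_transpose, ← dotProduct_mulVec, mulVec_mulVec,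
        nonsing_inv_mul _ (isUnit_iff_ne_zero.mpr hS), one_mulVec]
    rw [hg]
    simp only [toLin'_apply, mul_assoc, ← Finset.mul_sum]
    congr 1
    rw [← h2]
    push_cast
    ring
  simp_rw [h1]
  have h4 : ∫ x, g (toLin' S x) = ∫ y, g y ∂(Measure.map (toLin' S) volume) := by
    rw [integral_map]
    · exact (LinearMap.continuous_of_finiteDimensional (toLin' S)).aemeasurable
    · exact Continuous.aestronglyMeasurable (by fun_prop)
  rw [h4, Real.map_matrix_volume_pi_eq_smul_volume_pi hS, integral_smul_measure,
    GaussianFourier.integral_cexp_neg_mul_sum_add (by simpa using pi_pos)]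
  rw [ENNReal.toReal_ofReal (abs_nonneg _), div_self (by exact_mod_cast pi_ne_zero),
    Complex.one_cpow, one_mul, abs_inv, Complex.real_smul]
  congr 2
  simp_rw [mul_pow, ← Finset.mul_sum, Complex.I_sq]
  have : (π : ℂ) ≠ 0 := by exact_mod_cast pi_ne_zero
  field_simp
  ring

end Gaussian

end DedekindNorthcott

namespace DedekindNorthcott

open MeasureTheory Real Matrix

/-! ### The Poisson summation formula for Gaussian functions -/

section Poisson

variable {ι : Type*} [Fintype ι] [DecidableEq ι]

theorem summable_exp_neg_sum_sq_mulVec {S : Matrix ι ι ℝ} (hS : S.det ≠ 0) :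
    Summable fun m : ι → ℤ => Real.exp (-π * ∑ i, (S *ᵥ fun j => (m j : ℝ)) i ^ 2) := by
  obtain ⟨δ, hδ, h⟩ := exists_coercive hS
  refine (summable_exp_neg_sum_sq (ι := ι) (a := π * δ) (by positivity)).of_nonneg_of_le
    (fun m => (Real.exp_pos _).le) fun m => Real.exp_le_exp.mpr ?_
  have := mul_le_mul_of_nonneg_left (h fun j => (m j : ℝ)) pi_pos.le
  linarith

/-- The sum of the translates by `ℤ^ι` of the Gaussian `exp (-π |S x|²)`. -/
noncomputable def gaussianPeriodization (S : Matrix ι ι ℝ) (x : ι → ℝ) : ℂ :=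
  ∑' m : ι → ℤ, Complex.ofReal (Real.exp (-π * ∑ i, (S *ᵥ fun j => x j + m j) i ^ 2))

theorem continuous_gaussianPeriodization {S : Matrix ι ι ℝ} (hS : S.det ≠ 0) :
    Continuous (gaussianPeriodization S) := by
  obtain ⟨δ, hδ, h⟩ := exists_coercive hS
  have hon : ∀ R : ℝ, ContinuousOn (gaussianPeriodization S) {x | ∑ i, x i ^ 2 < R} := by
    intro R
    have hbound : ∀ (m : ι → ℤ) (x : ι → ℝ), ∑ i, x i ^ 2 < R →
        Real.exp (-π * ∑ i, (S *ᵥ fun j => x j + m j) i ^ 2) ≤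
          Real.exp (π * δ * R) * Real.exp (-(π * δ / 2) * ∑ i, (m i : ℝ) ^ 2) := by
      intro m x hx
      rw [← Real.exp_add]
      refine Real.exp_le_exp.mpr ?_
      have h1 := mul_le_mul_of_nonneg_left (h fun j => x j + m j) pi_pos.le
      have h3 : (∑ i, (m i : ℝ) ^ 2) / 2 - ∑ i, x i ^ 2 ≤ ∑ i, (x i + m i) ^ 2 := by
        rw [Finset.sum_div, ← Finset.sum_sub_distrib]
        refine Finset.sum_le_sum fun i _ => ?_
        nlinarith [sq_nonneg (2 * x i + m i)]
      have h2 : (∑ i, (m i : ℝ) ^ 2) / 2 - R ≤ ∑ i, (x i + m i) ^ 2 := by linarith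
      have h4 := mul_le_mul_of_nonneg_left h2 (mul_pos pi_pos hδ).le
      linarith
    refine continuousOn_tsum (fun m => Continuous.continuousOn ?_)
      ((summable_exp_neg_sum_sq (ι := ι) (a := π * δ / 2) (by positivity)).mul_left
        (Real.exp (π * δ * R))) fun m x hx => ?_
    · have : Continuous fun x : ι → ℝ => S *ᵥ fun j => x j + m j :=
        Continuous.matrix_mulVec continuous_const (by fun_prop)
      fun_prop
    · rw [Complex.norm_real, Real.norm_eq_abs, Real.abs_exp]
      exact hbound m x hx
  refine continuous_iff_continuousAt.mpr fun x₀ => ?_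
  exact (hon (∑ i, x₀ i ^ 2 + 1)).continuousAt
    ((isOpen_lt (by fun_prop) continuous_const).mem_nhds (lt_add_one (∑ i, x₀ i ^ 2)))

omit [DecidableEq ι] in
theorem gaussianPeriodization_add_int (S : Matrix ι ι ℝ) (x : ι → ℝ) (k : ι → ℤ) :
    gaussianPeriodization S (fun j => x j + k j) = gaussianPeriodization S x := by
  unfold gaussianPeriodization
  rw [← (Equiv.addLeft k).tsum_eq (fun m : ι → ℤ =>
    Complex.ofReal (Real.exp (-π * ∑ i, (S *ᵥ fun j => x j + m j) i ^ 2)))]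
  refine tsum_congr fun m => ?_
  simp [add_assoc]

/-- The periodized Gaussian as a continuous function on the torus. -/
theorem exists_torus_gaussianPeriodization {S : Matrix ι ι ℝ} (hS : S.det ≠ 0) :
    ∃ F : C(UnitAddTorus ι, ℂ), ∀ x : ι → ℝ,
      F (fun i => (x i : UnitAddCircle)) = gaussianPeriodization S x := by
  have hq : IsOpenQuotientMap (Pi.map fun _ : ι => fun y : ℝ => (y : UnitAddCircle)) :=
    IsOpenQuotientMap.piMap fun _ => QuotientAddGroup.isOpenQuotientMap_mk
  have hfac : Function.FactorsThrough (gaussianPeriodization S)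
      (Pi.map fun _ : ι => fun y : ℝ => (y : UnitAddCircle)) := by
    intro x y hxy
    have h1 : ∀ i, ∃ n : ℤ, x i = y i + n := by
      intro i
      have h2 : ((x i : ℝ) : UnitAddCircle) = (y i : ℝ) := congrFun hxy i
      rw [← sub_eq_zero, ← AddCircle.coe_sub, AddCircle.coe_eq_zero_iff] at h2
      obtain ⟨n, hn⟩ := h2
      exact ⟨n, by rw [zsmul_one] at hn; linarith⟩
    choose k hk using h1
    rw [show x = fun j => y j + k j from funext hk, gaussianPeriodization_add_int]
  set G : C(ι → ℝ, ℂ) := ⟨gaussianPeriodization S, continuous_gaussianPeriodization hS⟩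
  set Q : C(ι → ℝ, UnitAddTorus ι) := ⟨_, hq.continuous⟩
  have hQ : Topology.IsQuotientMap Q := hq.isQuotientMap
  exact ⟨hQ.lift G hfac, fun x => DFunLike.congr_fun (hQ.lift_comp G hfac) x⟩

/-- Integrating the periodization against a character over the torus unfolds to the Fourier transform
of the Gaussian. -/
theorem mFourierCoeff_gaussianPeriodization {S : Matrix ι ι ℝ} (hS : S.det ≠ 0)
    {F : UnitAddTorus ι → ℂ}
    (hF : ∀ x : ι → ℝ, F (fun i => (x i : UnitAddCircle)) = gaussianPeriodization S x)
    (n : ι → ℤ) :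
    UnitAddTorus.mFourierCoeff F n =
      |S.det|⁻¹ * (Real.exp (-π * ∑ i, ((S⁻¹)ᵀ *ᵥ fun j => (n j : ℝ)) i ^ 2) : ℂ) := by
  rw [UnitAddTorus.mFourierCoeff_eq_integral F n (fun _ => 0)]
  set g : (ι → ℝ) → ℂ := fun x => Complex.exp (-π * ∑ i, ((S *ᵥ x) i : ℂ) ^ 2
    - 2 * π * Complex.I * ∑ i, (n i : ℝ) * x i) with hg
  have hgnorm : ∀ x, ‖g x‖ = Real.exp (-π * ∑ i, (S *ᵥ x) i ^ 2) := by
    intro x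
    rw [hg, Complex.norm_exp]
    congr 1
    have h1 : (2 * π * Complex.I * ((∑ i, (n i : ℝ) * x i : ℝ) : ℂ)).re = 0 := by simp
    rw [Complex.sub_re, h1, sub_zero]
    rw [show (-(π : ℂ) * ∑ i, ((S *ᵥ x) i : ℂ) ^ 2)
      = ((-π * ∑ i, (S *ᵥ x) i ^ 2 : ℝ) : ℂ) by push_cast; rfl, Complex.ofReal_re]
  have hgc : Continuous g := by
    have : Continuous fun x : ι → ℝ => S *ᵥ x :=
      Continuous.matrix_mulVec continuous_const continuous_id
    fun_prop
  have hgi : Integrable g := by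
    refine (integrable_exp_neg_sum_sq_mulVec hS).mono' hgc.aestronglyMeasurable
      (ae_of_all _ fun x => (hgnorm x).le)
  -- translation by `m` as a measurable equivalence
  set τ : (ι → ℤ) → (ι → ℝ) ≃ᵐ (ι → ℝ) := fun m => MeasurableEquiv.addRight (fun j => (m j : ℝ))
  have hτ : ∀ m, MeasurePreserving (τ m) volume volume :=
    fun m => measurePreserving_add_right volume _
  have hτi : ∀ m, Integrable fun x => g (τ m x) := fun m => hgi.comp_add_right _
  have h1 := hasSum_integral_unitCube (p := fun x : ι → ℝ => x) measurable_id τ hτ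
    (fun m x i => rfl) hgi
  have h2 := hasSum_integral_unitCube (p := fun x : ι → ℝ => x) measurable_id τ hτ
    (fun m x i => rfl) hgi.norm
  have h3 := hasSum_integral_of_summable_integral_norm
    (μ := volume.restrict {x : ι → ℝ | ∀ i, x i ∈ Set.Ioc (0 : ℝ) (0 + 1)})
    (F := fun m x => g (τ m x)) (fun m => (hτi m).integrableOn) h2.summable
  have h4 := h1.unique h3
  have h5 := integral_gaussian_mulVec hS (fun i => (n i : ℝ))
  rw [hg] at h4
  rw [h4] at h5
  refine Eq.trans (integral_congr_ae (ae_of_all _ fun x => ?_)) (h5.trans (by push_cast; rfl))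
  -- the integrands agree, as the characters are invariant under integral translations
  simp only [hF, smul_eq_mul]
  rw [gaussianPeriodization, ← tsum_mul_left]
  refine tsum_congr fun m => ?_
  simp only [UnitAddTorus.mFourier, ContinuousMap.coe_mk, fourier_coe_apply, Pi.neg_apply]
  rw [← Complex.exp_sum, Complex.ofReal_exp, ← Complex.exp_add]
  rw [Complex.exp_eq_exp_iff_exists_int]
  refine ⟨∑ i, n i * m i, ?_⟩
  have h6 : ∀ i, (τ m x) i = x i + m i := fun i => rfl
  have h7 : τ m x = fun j => x j + m j := rfl
  simp only [h6]
  rw [h7]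
  push_cast
  simp only [mul_add, Finset.sum_add_distrib, Finset.mul_sum, Finset.sum_mul]
  have h8 : ∑ i, 2 * (π : ℂ) * Complex.I * -(n i : ℂ) * (x i : ℂ) / 1
    = - ∑ i, 2 * (π : ℂ) * Complex.I * ((n i : ℂ) * (x i : ℂ)) := by
    rw [← Finset.sum_neg_distrib]
    exact Finset.sum_congr rfl fun i _ => by ring
  have h9 : ∑ i, (n i : ℂ) * m i * (2 * (π : ℂ) * Complex.I)
    = ∑ i, 2 * (π : ℂ) * Complex.I * ((n i : ℂ) * (m i : ℂ)) :=
    Finset.sum_congr rfl fun i _ => by ring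
  rw [h8, h9]
  ring

/-- Poisson summation for the Gaussian `exp (-π |S x|²)` on `ℤ^ι`. -/
theorem tsum_exp_neg_sum_sq_mulVec {S : Matrix ι ι ℝ} (hS : S.det ≠ 0) :
    ∑' m : ι → ℤ, Real.exp (-π * ∑ i, (S *ᵥ fun j => (m j : ℝ)) i ^ 2)
      = |S.det|⁻¹ * ∑' m : ι → ℤ, Real.exp (-π * ∑ i, ((S⁻¹)ᵀ *ᵥ fun j => (m j : ℝ)) i ^ 2) := by
  obtain ⟨F, hF⟩ := exists_torus_gaussianPeriodization hS
  have hdet : (S⁻¹)ᵀ.det ≠ 0 := by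
    rw [det_transpose, det_nonsing_inv, Ring.inverse_eq_inv']
    exact inv_ne_zero hS
  have hcoeff := mFourierCoeff_gaussianPeriodization hS hF
  have hsum : Summable (UnitAddTorus.mFourierCoeff F) := by
    rw [show UnitAddTorus.mFourierCoeff F = _ from funext hcoeff]
    exact (Complex.summable_ofReal.mpr (summable_exp_neg_sum_sq_mulVec hdet)).mul_left _
  have h := (UnitAddTorus.hasSum_mFourier_series_apply_of_summable hsum
    (fun i => ((0 : ℝ) : UnitAddCircle))).tsum_eq
  rw [hF fun _ => 0] at h
  have h0 : ∀ n : ι → ℤ, UnitAddTorus.mFourier n (fun i => ((0 : ℝ) : UnitAddCircle)) = 1 := by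
    intro n
    simp [UnitAddTorus.mFourier]
  simp only [h0, hcoeff, smul_eq_mul, mul_one, gaussianPeriodization, zero_add] at h
  rw [tsum_mul_left, ← Complex.ofReal_tsum, ← Complex.ofReal_tsum, ← Complex.ofReal_mul] at h
  exact (Complex.ofReal_injective h).symm

end Poisson

end DedekindNorthcott

namespace DedekindNorthcott

open MeasureTheory Real Matrix NumberField

/-! ### Theta inversion for positive definite forms -/

section PosDef

variable {ι : Type*} [Fintype ι] [DecidableEq ι]

open scoped MatrixOrder in
theorem exists_transpose_mul_self {A : Matrix ι ι ℝ} (hA : A.PosDef) :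
    ∃ S : Matrix ι ι ℝ, S.det ≠ 0 ∧ A = Sᵀ * S := by
  obtain ⟨S, hS⟩ := CStarAlgebra.nonneg_iff_eq_star_mul_self.mp hA.posSemidef.nonneg
  have hS' : A = Sᵀ * S := by rw [hS, star_eq_conjTranspose, conjTranspose_eq_transpose_of_trivial]
  refine ⟨S, fun h => hA.det_pos.ne' ?_, hS'⟩
  rw [hS', det_mul, h, mul_zero]

omit [DecidableEq ι] in
theorem sum_mulVec_sq (S : Matrix ι ι ℝ) (x : ι → ℝ) :
    ∑ i, (S *ᵥ x) i ^ 2 = x ⬝ᵥ (Sᵀ * S) *ᵥ x := by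
  rw [← mulVec_mulVec, dotProduct_mulVec, vecMul_transpose]
  exact Finset.sum_congr rfl fun i _ => sq _

theorem exists_coercive_of_posDef {A : Matrix ι ι ℝ} (hA : A.PosDef) :
    ∃ δ > 0, ∀ x : ι → ℝ, δ * ∑ i, x i ^ 2 ≤ x ⬝ᵥ A *ᵥ x := by
  obtain ⟨S, hS, rfl⟩ := exists_transpose_mul_self hA
  simpa only [sum_mulVec_sq] using exists_coercive hS

/-- Poisson summation for the Gaussian attached to a positive definite matrix. -/
theorem tsum_exp_neg_posDef {A : Matrix ι ι ℝ} (hA : A.PosDef) :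
    ∑' m : ι → ℤ, Real.exp (-π * ((fun j => (m j : ℝ)) ⬝ᵥ A *ᵥ fun j => (m j : ℝ)))
      = (√A.det)⁻¹ *
        ∑' m : ι → ℤ, Real.exp (-π * ((fun j => (m j : ℝ)) ⬝ᵥ A⁻¹ *ᵥ fun j => (m j : ℝ))) := by
  obtain ⟨S, hS, rfl⟩ := exists_transpose_mul_self hA
  have h := tsum_exp_neg_sum_sq_mulVec hS
  simp only [sum_mulVec_sq, transpose_transpose] at h
  rw [h, det_mul, det_transpose, ← sq, Real.sqrt_sq_eq_abs, Matrix.mul_inv_rev,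
    ← transpose_nonsing_inv]

end PosDef

/-! ### Gram matrices of bases of a number field -/

section Gram

variable {K : Type*} [Field K] [NumberField K]

open ComplexEmbedding ComplexConjugate

/-- The Gram matrix of a `ℚ`-basis `b` of `K` for the form `∑_σ t_σ |σ x|²`. -/
noncomputable def gram (b : Module.Basis (K →+* ℂ) ℚ K) (t : (K →+* ℂ) → ℝ) :
    Matrix (K →+* ℂ) (K →+* ℂ) ℝ :=
  of fun i j => (∑ σ, (t σ : ℂ) * (conj (σ (b i)) * σ (b j))).re

/-- The matrix of all complex embeddings of the elements of a `ℚ`-basis. The basis is indexed by the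
embeddings themselves, so that the matrix is square. -/
noncomputable def embMatrix (b : Module.Basis (K →+* ℂ) ℚ K) :
    Matrix (K →+* ℂ) (K →+* ℂ) ℂ :=
  of fun i σ => σ (b i)

theorem gram_quadratic (b : Module.Basis (K →+* ℂ) ℚ K) (t : (K →+* ℂ) → ℝ)
    (x : (K →+* ℂ) → ℝ) :
    x ⬝ᵥ gram b t *ᵥ x = ∑ σ, t σ * ‖∑ i, (x i : ℂ) * σ (b i)‖ ^ 2 := by
  have h : ∀ σ : K →+* ℂ, (t σ * ‖∑ i, (x i : ℂ) * σ (b i)‖ ^ 2 : ℝ) =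
      ∑ i, ∑ j, x i * x j * ((t σ : ℂ) * (conj (σ (b i)) * σ (b j))).re := by
    intro σ
    rw [← Complex.ofReal_re (t σ * _)]
    push_cast
    rw [← Complex.conj_mul', map_sum, Finset.sum_mul_sum, Finset.mul_sum, Complex.re_sum]
    refine Finset.sum_congr rfl fun i _ => ?_
    rw [Finset.mul_sum, Complex.re_sum]
    refine Finset.sum_congr rfl fun j _ => ?_
    rw [map_mul, Complex.conj_ofReal, ← Complex.re_ofReal_mul]
    congr 1
    push_cast
    ring
  simp_rw [h]
  rw [Finset.sum_comm]
  simp only [dotProduct, mulVec, gram, of_apply, Finset.mul_sum, Complex.re_sum]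
  refine Finset.sum_congr rfl fun i _ => ?_
  rw [Finset.sum_comm]
  refine Finset.sum_congr rfl fun j _ => ?_
  rw [Finset.sum_mul, Finset.mul_sum]
  exact Finset.sum_congr rfl fun σ _ => by ring

theorem ofReal_gram (b : Module.Basis (K →+* ℂ) ℚ K) {t : (K →+* ℂ) → ℝ}
    (ht : ∀ σ, t (conjugate σ) = t σ) (i j : K →+* ℂ) :
    (gram b t i j : ℂ) = ∑ σ, (t σ : ℂ) * (conj (σ (b i)) * σ (b j)) := by
  rw [gram, of_apply]
  refine Complex.conj_eq_iff_re.mp ?_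
  rw [map_sum, ← Equiv.sum_comp (involutive_conjugate K).toPerm]
  refine Finset.sum_congr rfl fun σ _ => ?_
  simp [ht]

open scoped Classical in
/-- As the weights are invariant under conjugation, the Gram matrix is the product of the conjugate
embedding matrix, the diagonal matrix of the weights and the transposed embedding matrix. -/
theorem map_ofReal_gram (b : Module.Basis (K →+* ℂ) ℚ K) {t : (K →+* ℂ) → ℝ}
    (ht : ∀ σ, t (conjugate σ) = t σ) :
    (gram b t).map Complex.ofReal =
      (embMatrix b).map conj * diagonal (fun σ => (t σ : ℂ)) * (embMatrix b)ᵀ := by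
  ext i j
  rw [map_apply, ofReal_gram b ht, mul_apply]
  refine Finset.sum_congr rfl fun σ _ => ?_
  rw [mul_diagonal, map_apply, transpose_apply, embMatrix, of_apply, of_apply]
  ring

open scoped Classical in
/-- The conjugate of `map_ofReal_gram`; the left-hand side is real. -/
theorem map_ofReal_gram' (b : Module.Basis (K →+* ℂ) ℚ K) {t : (K →+* ℂ) → ℝ}
    (ht : ∀ σ, t (conjugate σ) = t σ) :
    (gram b t).map Complex.ofReal =
      embMatrix b * diagonal (fun σ => (t σ : ℂ)) * ((embMatrix b).map conj)ᵀ := by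
  have h := congrArg (fun M : Matrix (K →+* ℂ) (K →+* ℂ) ℂ => M.map conj) (map_ofReal_gram b ht)
  simp only [Matrix.map_mul] at h
  convert h using 1
  · ext i j; simp
  · congr 1
    congr 1
    · ext i j; simp
    · ext i j; by_cases hij : i = j <;> simp [diagonal, hij]

open scoped Classical in
theorem embMatrix_mul_transpose_traceDual (b : Module.Basis (K →+* ℂ) ℚ K) :
    embMatrix b * (embMatrix b.traceDual)ᵀ = 1 := by
  ext i j
  rw [mul_apply]
  have h := trace_eq_sum_embeddings ℂ (K := ℚ) (x := b i * b.traceDual j)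
  rw [b.trace_mul_traceDual, ← (RingHom.equivRatAlgHom K ℂ).sum_comp] at h
  rw [one_apply]
  convert h.symm using 1
  · refine Finset.sum_congr rfl fun σ _ => ?_
    simp [embMatrix]
  · split_ifs <;> simp

open scoped Classical in
theorem norm_det_embMatrix_sq (b : Module.Basis (K →+* ℂ) ℚ K) :
    ‖(embMatrix b).det‖ ^ 2 = |(Algebra.discr ℚ b : ℝ)| := by
  have h := Algebra.discr_eq_det_embeddingsMatrixReindex_pow_two ℚ ℂ b (RingHom.equivRatAlgHom K ℂ)
  have h2 : Algebra.embeddingsMatrixReindex ℚ ℂ b (RingHom.equivRatAlgHom K ℂ) = embMatrix b := by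
    ext i j
    simp [Algebra.embeddingsMatrixReindex, embMatrix]
  rw [h2] at h
  rw [← norm_pow, ← h]
  simp

open scoped Classical in
theorem det_embMatrix_ne_zero (b : Module.Basis (K →+* ℂ) ℚ K) : (embMatrix b).det ≠ 0 := by
  have h := norm_det_embMatrix_sq b
  have h2 := Algebra.discr_not_zero_of_basis ℚ b
  intro h3
  rw [h3, norm_zero, zero_pow two_ne_zero, eq_comm, abs_eq_zero] at h
  exact h2 (by exact_mod_cast h)

open scoped Classical in
theorem det_gram (b : Module.Basis (K →+* ℂ) ℚ K) {t : (K →+* ℂ) → ℝ}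
    (ht : ∀ σ, t (conjugate σ) = t σ) :
    (gram b t).det = |(Algebra.discr ℚ b : ℝ)| * ∏ σ, t σ := by
  have h := congrArg det (map_ofReal_gram b ht)
  have h1 : ((embMatrix b).map conj).det = conj (embMatrix b).det :=
    ((starRingEnd ℂ).map_det _).symm
  have h2 : ((gram b t).map Complex.ofReal).det = ((gram b t).det : ℂ) :=
    (Complex.ofRealHom.map_det _).symm
  rw [h2, det_mul, det_mul, det_transpose, det_diagonal, h1] at h
  apply Complex.ofReal_injective
  rw [h, ← norm_det_embMatrix_sq]
  push_cast
  rw [← Complex.conj_mul']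
  ring

open scoped Classical in
/-- Passing to the trace dual basis and inverting the weights inverts the Gram matrix. -/
theorem gram_mul_gram_traceDual (b : Module.Basis (K →+* ℂ) ℚ K) {t : (K →+* ℂ) → ℝ}
    (ht : ∀ σ, t (conjugate σ) = t σ) (ht0 : ∀ σ, 0 < t σ) :
    gram b t * gram b.traceDual t⁻¹ = 1 := by
  have ht' : ∀ σ, t⁻¹ (conjugate σ) = t⁻¹ σ := fun σ => by simp [ht]
  have h1 : ((embMatrix b).map conj)ᵀ * (embMatrix b.traceDual).map conj = 1 := by
    have h2 := mul_eq_one_comm.mp (embMatrix_mul_transpose_traceDual b)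
    have h3 := congrArg (fun M => (transpose M).map conj) h2
    simpa [Matrix.map_mul, transpose_mul, transpose_map] using h3
  have h2 : (gram b t * gram b.traceDual t⁻¹).map Complex.ofReal = 1 := by
    have : (gram b t * gram b.traceDual t⁻¹).map Complex.ofReal =
        (gram b t).map Complex.ofReal * (gram b.traceDual t⁻¹).map Complex.ofReal :=
      Matrix.map_mul (f := Complex.ofRealHom)
    rw [this, map_ofReal_gram' b ht, map_ofReal_gram _ ht']
    calc embMatrix b * diagonal (fun σ => (t σ : ℂ)) * ((embMatrix b).map conj)ᵀ *
          ((embMatrix b.traceDual).map conj * diagonal (fun σ => ((t⁻¹ σ : ℝ) : ℂ)) *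
            (embMatrix b.traceDual)ᵀ)
        = embMatrix b * (diagonal (fun σ => (t σ : ℂ)) *
          (((embMatrix b).map conj)ᵀ * (embMatrix b.traceDual).map conj) *
          diagonal (fun σ => ((t⁻¹ σ : ℝ) : ℂ))) * (embMatrix b.traceDual)ᵀ := by
          simp only [Matrix.mul_assoc]
      _ = 1 := by
          rw [h1, Matrix.mul_one, diagonal_mul_diagonal]
          have : (fun σ => (t σ : ℂ) * ((t⁻¹ σ : ℝ) : ℂ)) = fun _ => 1 := by
            funext σ
            rw [Pi.inv_apply, Complex.ofReal_inv]
            exact mul_inv_cancel₀ (Complex.ofReal_ne_zero.mpr (ht0 σ).ne')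
          rw [this, diagonal_one, Matrix.mul_one, embMatrix_mul_transpose_traceDual]
  ext i j
  have h3 := congrFun (congrFun h2 i) j
  rw [map_apply, one_apply] at h3
  rw [one_apply]
  apply Complex.ofReal_injective
  rw [h3]
  split_ifs <;> simp

open scoped Classical in
theorem posDef_gram (b : Module.Basis (K →+* ℂ) ℚ K) {t : (K →+* ℂ) → ℝ}
    (ht : ∀ σ, t (conjugate σ) = t σ) (ht0 : ∀ σ, 0 < t σ) : (gram b t).PosDef := by
  refine PosDef.of_dotProduct_mulVec_pos ?_ fun x hx => ?_
  · ext i j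
    apply Complex.ofReal_injective
    rw [conjTranspose_apply, star_trivial]
    rw [← Complex.conj_ofReal, ofReal_gram b ht, ofReal_gram b ht, map_sum]
    refine Finset.sum_congr rfl fun σ _ => ?_
    simp [mul_comm]
  · rw [star_trivial, gram_quadratic]
    have hnn : ∀ σ ∈ Finset.univ, 0 ≤ t σ * ‖∑ i, (x i : ℂ) * σ (b i)‖ ^ 2 :=
      fun σ _ => mul_nonneg (ht0 σ).le (sq_nonneg _)
    refine (Finset.sum_nonneg hnn).lt_of_ne fun h0 => hx ?_
    have h1 := (Finset.sum_eq_zero_iff_of_nonneg hnn).mp h0.symm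
    have h2 : (fun i => (x i : ℂ)) ᵥ* embMatrix b = 0 := by
      funext σ
      have h3 := h1 σ (Finset.mem_univ _)
      have h4 : ‖∑ i, (x i : ℂ) * σ (b i)‖ = 0 := by
        have := (ht0 σ).ne'
        simpa [this] using h3
      exact norm_eq_zero.mp h4
    have h5 := Matrix.eq_zero_of_vecMul_eq_zero (det_embMatrix_ne_zero b) h2
    funext i
    have := congrFun h5 i
    simpa using this

end Gram

end DedekindNorthcott

namespace DedekindNorthcott

open MeasureTheory Real Matrix NumberField
open scoped nonZeroDivisors

/-! ### Theta series of fractional ideals -/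

section Theta

variable {K : Type*} [Field K] [NumberField K]

open ComplexEmbedding ComplexConjugate

/-- The quadratic form `∑_σ t_σ |σ x|²` on `K` with weights `t_σ`, where `σ` runs over all complex
embeddings (so that each complex place contributes two terms). -/
noncomputable def embForm (t : (K →+* ℂ) → ℝ) (x : K) : ℝ := ∑ σ, t σ * ‖σ x‖ ^ 2

/-- The theta series `∑_{x ∈ S} exp (-π ∑_σ t_σ |σ x|²)` of a subset `S` of `K`. -/
noncomputable def theta (S : Set K) (t : (K →+* ℂ) → ℝ) : ℝ :=
  ∑' x : S, Real.exp (-π * embForm t (x : K))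

theorem embForm_mono {t t' : (K →+* ℂ) → ℝ} (h : ∀ σ, t σ ≤ t' σ) (x : K) :
    embForm t x ≤ embForm t' x :=
  Finset.sum_le_sum fun σ _ => mul_le_mul_of_nonneg_right (h σ) (sq_nonneg _)

theorem embForm_zero (t : (K →+* ℂ) → ℝ) : embForm t 0 = 0 := by simp [embForm]

theorem embForm_const_mul (a : ℝ) (t : (K →+* ℂ) → ℝ) (x : K) :
    embForm (fun σ => a * t σ) x = a * embForm t x := by
  simp only [embForm, Finset.mul_sum, mul_assoc]

theorem embForm_const (a : ℝ) (x : K) :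
    embForm (fun _ => a) x = a * embForm (fun _ => 1) x := by
  simpa using embForm_const_mul a (fun _ => 1) x

/-- Integral coordinates on the `ℤ`-span of a `ℚ`-basis of `K`. -/
noncomputable def coordEquiv (b : Module.Basis (K →+* ℂ) ℚ K) {S : Set K}
    (hS : S = (Submodule.span ℤ (Set.range b) : Set K)) : ((K →+* ℂ) → ℤ) ≃ S :=
  (b.restrictScalars ℤ).equivFun.symm.toEquiv.trans (Equiv.setCongr hS.symm)

theorem coordEquiv_apply (b : Module.Basis (K →+* ℂ) ℚ K) {S : Set K}
    (hS : S = (Submodule.span ℤ (Set.range b) : Set K)) (m : (K →+* ℂ) → ℤ) :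
    (coordEquiv b hS m : K) = ∑ i, (m i : K) * b i := by
  have h : (coordEquiv b hS m : K) =
      (((b.restrictScalars ℤ).equivFun.symm m : Submodule.span ℤ (Set.range b)) : K) := rfl
  rw [h, Module.Basis.equivFun_symm_apply]
  simp [Module.Basis.restrictScalars_apply]

theorem embForm_coordEquiv (b : Module.Basis (K →+* ℂ) ℚ K) {S : Set K}
    (hS : S = (Submodule.span ℤ (Set.range b) : Set K)) (t : (K →+* ℂ) → ℝ)
    (m : (K →+* ℂ) → ℤ) :
    embForm t (coordEquiv b hS m : K) =
      (fun j => (m j : ℝ)) ⬝ᵥ gram b t *ᵥ fun j => (m j : ℝ) := by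
  rw [gram_quadratic, coordEquiv_apply]
  simp [embForm]

theorem theta_eq_tsum_gram (b : Module.Basis (K →+* ℂ) ℚ K) {S : Set K}
    (hS : S = (Submodule.span ℤ (Set.range b) : Set K)) (t : (K →+* ℂ) → ℝ) :
    theta S t = ∑' m : (K →+* ℂ) → ℤ,
      Real.exp (-π * ((fun j => (m j : ℝ)) ⬝ᵥ gram b t *ᵥ fun j => (m j : ℝ))) := by
  rw [theta, ← (coordEquiv b hS).tsum_eq]
  simp only [embForm_coordEquiv]

open scoped Classical in
theorem theta_span_inversion (b : Module.Basis (K →+* ℂ) ℚ K) {S S' : Set K}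
    (hS : S = (Submodule.span ℤ (Set.range b) : Set K))
    (hS' : S' = (Submodule.span ℤ (Set.range b.traceDual) : Set K))
    {t : (K →+* ℂ) → ℝ} (ht : ∀ σ, t (conjugate σ) = t σ) (ht0 : ∀ σ, 0 < t σ) :
    theta S t = (√(|(Algebra.discr ℚ b : ℝ)| * ∏ σ, t σ))⁻¹ * theta S' t⁻¹ := by
  rw [theta_eq_tsum_gram b hS, theta_eq_tsum_gram _ hS', tsum_exp_neg_posDef (posDef_gram b ht ht0),
    det_gram b ht, inv_eq_right_inv (gram_mul_gram_traceDual b ht ht0)]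

/-- The covolume of the fractional ideal `I`, as a lattice in `K ⊗ ℝ`, up to a power of `2`. -/
noncomputable def latticeVol (I : (FractionalIdeal (𝓞 K)⁰ K)ˣ) : ℝ :=
  √|(discr K : ℝ)| * (FractionalIdeal.absNorm (I : FractionalIdeal (𝓞 K)⁰ K) : ℝ)

theorem latticeVol_pos (I : (FractionalIdeal (𝓞 K)⁰ K)ˣ) : 0 < latticeVol I := by
  have h1 : (0 : ℝ) < |(discr K : ℝ)| := abs_pos.mpr (Int.cast_ne_zero.mpr (discr_ne_zero K))
  have h2 : FractionalIdeal.absNorm (I : FractionalIdeal (𝓞 K)⁰ K) ≠ 0 :=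
    fun h => I.ne_zero (FractionalIdeal.absNorm_eq_zero_iff.mp h)
  have h3 : (0 : ℚ) < FractionalIdeal.absNorm (I : FractionalIdeal (𝓞 K)⁰ K) :=
    lt_of_le_of_ne (FractionalIdeal.absNorm_nonneg _) h2.symm
  exact mul_pos (Real.sqrt_pos.mpr h1) (by exact_mod_cast h3)

open scoped Classical in
/-- A fractional ideal is the `ℤ`-span of a `ℚ`-basis of `K`, indexed here by the complex embeddings,
whose discriminant is the square of its normalized covolume. -/
theorem exists_basis_fractionalIdeal (I : (FractionalIdeal (𝓞 K)⁰ K)ˣ) :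
    ∃ b : Module.Basis (K →+* ℂ) ℚ K,
      ((I : FractionalIdeal (𝓞 K)⁰ K) : Set K) = (Submodule.span ℤ (Set.range b) : Set K) ∧
      |(Algebra.discr ℚ b : ℝ)| = latticeVol I ^ 2 := by
  classical
  have hcard : Fintype.card (Module.Free.ChooseBasisIndex ℤ (𝓞 K)) =
      Fintype.card (Module.Free.ChooseBasisIndex ℤ I) := by
    rw [← Module.finrank_eq_card_chooseBasisIndex, ← Module.finrank_eq_card_chooseBasisIndex,
      fractionalIdeal_rank]
  let e := Fintype.equivOfCardEq hcard
  let b₁ := (basisOfFractionalIdeal K I).reindex e.symm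
  let b := b₁.reindex (equivReindex K).symm
  refine ⟨b, ?_, ?_⟩
  · have : Set.range b = Set.range (basisOfFractionalIdeal K I) := by
      simp only [b, b₁, Module.Basis.range_reindex]
    ext x
    rw [this]
    exact (mem_span_basisOfFractionalIdeal K).symm
  · have h1 : Algebra.discr ℚ b = Algebra.discr ℚ b₁ := by
      rw [Module.Basis.coe_reindex, Algebra.discr_reindex]
    have h2 : Algebra.discr ℚ b₁ = ((integralBasis K).det b₁) ^ 2 * discr K := by
      rw [coe_discr, Module.Basis.det_apply, ← Algebra.discr_of_matrix_vecMul,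
        Module.Basis.toMatrix_map_vecMul]
    have h3 := det_basisOfFractionalIdeal_eq_absNorm K I e
    rw [h1, h2, ← sq_abs, h3, latticeVol, mul_pow, Real.sq_sqrt (abs_nonneg _)]
    push_cast
    rw [abs_mul, abs_of_nonneg (sq_nonneg _)]
    ring

/-- The dual of a fractional ideal with respect to the trace form. -/
noncomputable def dualIdeal (I : (FractionalIdeal (𝓞 K)⁰ K)ˣ) : (FractionalIdeal (𝓞 K)⁰ K)ˣ :=
  Units.mk0 (FractionalIdeal.dual ℤ ℚ I) (FractionalIdeal.dual_ne_zero ℤ ℚ I.ne_zero)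

theorem latticeVol_dualIdeal (I : (FractionalIdeal (𝓞 K)⁰ K)ˣ) :
    latticeVol (dualIdeal I) = (latticeVol I)⁻¹ := by
  have hd : (0 : ℝ) < |(discr K : ℝ)| := abs_pos.mpr (Int.cast_ne_zero.mpr (discr_ne_zero K))
  have h1 : FractionalIdeal.absNorm (FractionalIdeal.dual ℤ ℚ (1 : FractionalIdeal (𝓞 K)⁰ K)) *
      |(discr K : ℚ)| = 1 := by
    have h2 := coeIdeal_differentIdeal ℤ ℚ K (𝓞 K)
    have h3 := congrArg FractionalIdeal.absNorm h2
    rw [FractionalIdeal.coeIdeal_absNorm, absNorm_differentIdeal (K := K), map_inv₀,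
      Nat.cast_natAbs, Int.cast_abs] at h3
    rw [h3, mul_inv_cancel₀]
    intro h
    rw [h, _root_.inv_zero, abs_eq_zero] at h3
    exact discr_ne_zero K (by exact_mod_cast h3)
  have h4 : FractionalIdeal.absNorm (dualIdeal I : FractionalIdeal (𝓞 K)⁰ K) *
      FractionalIdeal.absNorm (I : FractionalIdeal (𝓞 K)⁰ K) * |(discr K : ℚ)| = 1 := by
    rw [← map_mul]
    have : (dualIdeal I : FractionalIdeal (𝓞 K)⁰ K) * I =
        FractionalIdeal.dual ℤ ℚ (1 : FractionalIdeal (𝓞 K)⁰ K) :=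
      FractionalIdeal.dual_mul_self ℤ ℚ I.ne_zero
    rw [this, h1]
  have h5 : (FractionalIdeal.absNorm (dualIdeal I : FractionalIdeal (𝓞 K)⁰ K) : ℝ) *
      FractionalIdeal.absNorm (I : FractionalIdeal (𝓞 K)⁰ K) * |(discr K : ℝ)| = 1 := by
    exact_mod_cast h4
  refine eq_inv_of_mul_eq_one_left ?_
  unfold latticeVol
  have h6 := Real.mul_self_sqrt hd.le
  calc _ = (FractionalIdeal.absNorm (dualIdeal I : FractionalIdeal (𝓞 K)⁰ K) : ℝ) *
      FractionalIdeal.absNorm (I : FractionalIdeal (𝓞 K)⁰ K) *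
        (√|(discr K : ℝ)| * √|(discr K : ℝ)|) := by ring
    _ = 1 := by rw [h6, h5]

/-- The theta inversion formula for a fractional ideal and its trace dual. -/
theorem theta_inversion (I : (FractionalIdeal (𝓞 K)⁰ K)ˣ)
    {t : (K →+* ℂ) → ℝ} (ht : ∀ σ, t (conjugate σ) = t σ) (ht0 : ∀ σ, 0 < t σ) :
    theta ((I : FractionalIdeal (𝓞 K)⁰ K) : Set K) t =
      (latticeVol I * √(∏ σ, t σ))⁻¹ *
        theta ((dualIdeal I : FractionalIdeal (𝓞 K)⁰ K) : Set K) t⁻¹ := by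
  classical
  obtain ⟨b, hb, hd⟩ := exists_basis_fractionalIdeal I
  have hdual : ((dualIdeal I : FractionalIdeal (𝓞 K)⁰ K) : Set K) =
      (Submodule.span ℤ (Set.range b.traceDual) : Set K) := by
    have h1 : ((I : FractionalIdeal (𝓞 K)⁰ K) : Submodule (𝓞 K) K).restrictScalars ℤ =
        Submodule.span ℤ (Set.range b) := SetLike.coe_injective hb
    have h2 := Submodule.traceDual_span_of_basis ℤ _ b h1
    rw [← h2, ← FractionalIdeal.coe_dual ℤ ℚ I.ne_zero]
    rfl
  rw [theta_span_inversion b hb hdual ht ht0, hd, Real.sqrt_mul (sq_nonneg _),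
    Real.sqrt_sq (latticeVol_pos I).le]

/-- The form `∑_σ |σ x|²` is bounded away from zero on the nonzero elements of a fractional ideal. -/
theorem exists_form_gap (I : (FractionalIdeal (𝓞 K)⁰ K)ˣ) :
    ∃ δ > 0, ∀ x ∈ ((I : FractionalIdeal (𝓞 K)⁰ K) : Set K), x ≠ 0 →
      δ ≤ embForm (fun _ => 1) x := by
  classical
  obtain ⟨b, hb, -⟩ := exists_basis_fractionalIdeal I
  obtain ⟨δ, hδ, h⟩ := exists_coercive_of_posDef (posDef_gram b (t := fun _ => 1)
    (fun _ => rfl) fun _ => one_pos)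
  refine ⟨δ, hδ, fun x hx hx0 => ?_⟩
  obtain ⟨m, hm⟩ := (coordEquiv b hb).surjective ⟨x, hx⟩
  have hm' : x = coordEquiv b hb m := by rw [hm]
  rw [hm', embForm_coordEquiv]
  refine le_trans ?_ (h _)
  have hm0 : m ≠ 0 := by
    rintro rfl
    exact hx0 (by rw [hm', coordEquiv_apply]; simp)
  obtain ⟨i, hi⟩ := Function.ne_iff.mp hm0
  have h1 : (1 : ℝ) ≤ (m i : ℝ) ^ 2 := by
    have : 1 ≤ (m i) ^ 2 := Int.add_one_le_iff.mpr (sq_pos_of_ne_zero hi)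
    exact_mod_cast this
  have h2 := Finset.single_le_sum (f := fun j => (m j : ℝ) ^ 2) (fun j _ => sq_nonneg _)
    (Finset.mem_univ i)
  have h3 : (1 : ℝ) ≤ ∑ j, (m j : ℝ) ^ 2 := h1.trans h2
  nlinarith

theorem summable_theta_const (I : (FractionalIdeal (𝓞 K)⁰ K)ˣ) {a : ℝ} (ha : 0 < a) :
    Summable fun x : ((I : FractionalIdeal (𝓞 K)⁰ K) : Set K) =>
      Real.exp (-π * (a * embForm (fun _ => 1) (x : K))) := by
  classical
  obtain ⟨b, hb, -⟩ := exists_basis_fractionalIdeal I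
  obtain ⟨S, hS, hA⟩ := exists_transpose_mul_self (posDef_gram b (t := fun _ => a)
    (fun _ => rfl) fun _ => ha)
  rw [← (coordEquiv b hb).summable_iff]
  refine (summable_exp_neg_sum_sq_mulVec hS).congr fun m => ?_
  rw [Function.comp_apply, ← embForm_const, embForm_coordEquiv, hA, sum_mulVec_sq]

theorem summable_theta (I : (FractionalIdeal (𝓞 K)⁰ K)ˣ) {t : (K →+* ℂ) → ℝ} {a : ℝ}
    (ha : 0 < a) (ht : ∀ σ, a ≤ t σ) :
    Summable fun x : ((I : FractionalIdeal (𝓞 K)⁰ K) : Set K) =>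
      Real.exp (-π * embForm t (x : K)) := by
  refine (summable_theta_const I ha).of_nonneg_of_le (fun x => (Real.exp_pos _).le)
    fun x => Real.exp_le_exp.mpr ?_
  have := mul_le_mul_of_nonneg_left (embForm_mono ht (x : K)) pi_pos.le
  rw [embForm_const] at this
  linarith

end Theta

end DedekindNorthcott

namespace DedekindNorthcott

open MeasureTheory Real NumberField
open scoped nonZeroDivisors

/-! ### Averaging theta series over the units -/

section UnitTheta

variable {K : Type*} [Field K] [NumberField K]

open ComplexEmbedding ComplexConjugate NumberField.Units

/-- The weights `σ ↦ ∏_i |σ ε_i|^(2 c_i)`, where `ε` is a fundamental system of units. -/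
noncomputable def unitWeight (c : Fin (rank K) → ℝ) (σ : K →+* ℂ) : ℝ :=
  Real.exp (∑ i, c i * (2 * Real.log ‖σ (fundSystem K i : K)‖))

/-- The unit `∏_i ε_i^(k_i)`. -/
noncomputable def fundUnit (k : Fin (rank K) → ℤ) : (𝓞 K)ˣ := ∏ i, fundSystem K i ^ k i

theorem unitWeight_pos (c : Fin (rank K) → ℝ) (σ : K →+* ℂ) : 0 < unitWeight c σ :=
  Real.exp_pos _

theorem unitWeight_conjugate (c : Fin (rank K) → ℝ) (σ : K →+* ℂ) :
    unitWeight c (conjugate σ) = unitWeight c σ := by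
  simp [unitWeight]

theorem unitWeight_neg (c : Fin (rank K) → ℝ) (σ : K →+* ℂ) :
    unitWeight (-c) σ = (unitWeight c σ)⁻¹ := by
  rw [unitWeight, unitWeight, ← Real.exp_neg, ← Finset.sum_neg_distrib]
  simp

theorem continuous_unitWeight (σ : K →+* ℂ) :
    Continuous fun c : Fin (rank K) → ℝ => unitWeight c σ := by
  unfold unitWeight
  fun_prop

theorem prod_norm_embedding_unit (u : (𝓞 K)ˣ) : ∏ σ : K →+* ℂ, ‖σ (u : K)‖ = 1 := by
  have h := Algebra.norm_eq_prod_embeddings ℚ ℂ (u : K)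
  rw [← (RingHom.equivRatAlgHom K ℂ).prod_comp] at h
  have h2 := congrArg norm h
  rw [norm_prod] at h2
  have h3 : ‖(algebraMap ℚ ℂ) (Algebra.norm ℚ (u : K))‖ = 1 := by
    rw [eq_ratCast, Complex.norm_ratCast]
    have := NumberField.Units.norm (K := K) u
    exact_mod_cast this
  rw [h3] at h2
  exact h2.symm

omit [NumberField K] in
theorem norm_embedding_unit_pos (u : (𝓞 K)ˣ) (σ : K →+* ℂ) : 0 < ‖σ (u : K)‖ :=
  norm_pos_iff.mpr ((map_ne_zero σ).mpr (coe_ne_zero u))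

theorem sum_log_embedding_unit (u : (𝓞 K)ˣ) : ∑ σ : K →+* ℂ, Real.log ‖σ (u : K)‖ = 0 := by
  rw [← Real.log_prod fun σ _ => (norm_embedding_unit_pos u σ).ne', prod_norm_embedding_unit,
    Real.log_one]

theorem prod_unitWeight (c : Fin (rank K) → ℝ) : ∏ σ : K →+* ℂ, unitWeight c σ = 1 := by
  unfold unitWeight
  rw [← Real.exp_sum, Finset.sum_comm]
  have : ∀ i, ∑ σ : K →+* ℂ, c i * (2 * Real.log ‖σ (fundSystem K i : K)‖) = 0 := fun i => by
    rw [← Finset.mul_sum, ← Finset.mul_sum, sum_log_embedding_unit, mul_zero, mul_zero]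
  simp [this]

theorem unitWeight_add_int (c : Fin (rank K) → ℝ) (k : Fin (rank K) → ℤ) (σ : K →+* ℂ) :
    unitWeight (fun i => c i + k i) σ = unitWeight c σ * ‖σ (fundUnit k : K)‖ ^ 2 := by
  have h : ‖σ (fundUnit k : K)‖ ^ 2 =
      Real.exp (∑ i, k i * (2 * Real.log ‖σ (fundSystem K i : K)‖)) := by
    rw [← Real.exp_log (pow_pos (norm_embedding_unit_pos (fundUnit k) σ) 2)]
    congr 1
    rw [Real.log_pow]
    have h1 : ‖σ (fundUnit k : K)‖ = ∏ i, ‖σ (fundSystem K i : K)‖ ^ k i := by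
      have : (fundUnit k : K) = ∏ i, (fundSystem K i : K) ^ k i := by
        have h2 : (fundUnit k : K) = Units.coeHom K
            (Units.map (algebraMap (𝓞 K) K).toMonoidHom (fundUnit k)) := rfl
        rw [h2, fundUnit, map_prod, map_prod]
        refine Finset.prod_congr rfl fun i _ => ?_
        rw [map_zpow, map_zpow]
        rfl
      rw [this, map_prod, norm_prod]
      simp
    rw [h1, Real.log_prod fun i _ => (zpow_pos (norm_embedding_unit_pos _ σ) _).ne',
      Finset.mul_sum]
    refine Finset.sum_congr rfl fun i _ => ?_
    rw [Real.log_zpow]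
    push_cast
    ring
  rw [h, unitWeight, unitWeight, ← Real.exp_add, ← Finset.sum_add_distrib]
  simp only [add_mul]

/-- The weights `y · unitWeight c`. -/
noncomputable def scaledWeight (y : ℝ) (c : Fin (rank K) → ℝ) (σ : K →+* ℂ) : ℝ :=
  y * unitWeight c σ

theorem scaledWeight_pos {y : ℝ} (hy : 0 < y) (c : Fin (rank K) → ℝ) (σ : K →+* ℂ) :
    0 < scaledWeight y c σ := mul_pos hy (unitWeight_pos c σ)

theorem embForm_scaledWeight_add_int (y : ℝ) (c : Fin (rank K) → ℝ) (k : Fin (rank K) → ℤ)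
    (x : K) : embForm (scaledWeight y fun i => c i + k i) x =
      embForm (scaledWeight y c) (x * (fundUnit k : K)) := by
  refine Finset.sum_congr rfl fun σ _ => ?_
  rw [scaledWeight, scaledWeight, unitWeight_add_int, map_mul, norm_mul]
  ring

/-- Multiplication by a unit permutes a fractional ideal. -/
noncomputable def mulUnitEquiv (I : FractionalIdeal (𝓞 K)⁰ K) (u : (𝓞 K)ˣ) :
    (I : Set K) ≃ (I : Set K) where
  toFun x := ⟨(x : K) * (u : K), by
    have := (I : Submodule (𝓞 K) K).smul_mem (u : 𝓞 K) x.2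
    rwa [Algebra.smul_def, mul_comm] at this⟩
  invFun x := ⟨(x : K) * ((u⁻¹ : (𝓞 K)ˣ) : K), by
    have := (I : Submodule (𝓞 K) K).smul_mem ((u⁻¹ : (𝓞 K)ˣ) : 𝓞 K) x.2
    rwa [Algebra.smul_def, mul_comm] at this⟩
  left_inv x := by
    ext
    simp only [mul_assoc, ← Units.coe_mul]
    simp
  right_inv x := by
    ext
    simp only [mul_assoc, ← Units.coe_mul]
    simp

/-- The theta series is periodic in `c`, as multiplication by units permutes `I`. -/
theorem theta_scaledWeight_add_int (I : FractionalIdeal (𝓞 K)⁰ K) (y : ℝ)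
    (c : Fin (rank K) → ℝ) (k : Fin (rank K) → ℤ) :
    theta (I : Set K) (scaledWeight y fun i => c i + k i) = theta (I : Set K) (scaledWeight y c) := by
  unfold theta
  rw [← (mulUnitEquiv I (fundUnit k)).tsum_eq (fun x : (I : Set K) =>
    Real.exp (-π * embForm (scaledWeight y c) (x : K)))]
  simp only [embForm_scaledWeight_add_int]
  rfl

theorem continuousOn_theta (I : (FractionalIdeal (𝓞 K)⁰ K)ˣ) :
    ContinuousOn (theta ((I : FractionalIdeal (𝓞 K)⁰ K) : Set K)) {t | ∀ σ, 0 < t σ} := by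
  intro t ht
  obtain ⟨a, ha, hat⟩ : ∃ a > 0, ∀ σ, a < t σ := by
    obtain ⟨σ₀, hσ₀⟩ := Finite.exists_min t
    exact ⟨t σ₀ / 2, half_pos (ht σ₀), fun σ => (half_lt_self (ht σ₀)).trans_le (hσ₀ σ)⟩
  have hopen : IsOpen {t : (K →+* ℂ) → ℝ | ∀ σ, a < t σ} := by
    simp only [Set.ofPred_forall]
    exact isOpen_iInter_of_finite fun σ => isOpen_lt continuous_const (continuous_apply σ)
  have hbound : ∀ (x : ((I : FractionalIdeal (𝓞 K)⁰ K) : Set K)) (t : (K →+* ℂ) → ℝ),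
      (∀ σ, a < t σ) → Real.exp (-π * embForm t (x : K)) ≤
        Real.exp (-π * (a * embForm (fun _ => 1) (x : K))) := by
    intro x t ht
    refine Real.exp_le_exp.mpr ?_
    have := mul_le_mul_of_nonneg_left (embForm_mono (fun σ => (ht σ).le) (x : K)) pi_pos.le
    rw [embForm_const] at this
    linarith
  have hon : ContinuousOn (theta ((I : FractionalIdeal (𝓞 K)⁰ K) : Set K)) {t | ∀ σ, a < t σ} := by
    refine continuousOn_tsum (fun x => Continuous.continuousOn ?_) (summable_theta_const I ha)
      fun x t ht => ?_
    · unfold embForm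
      fun_prop
    · rw [Real.norm_eq_abs, Real.abs_exp]
      exact hbound x t ht
  exact (hon.continuousAt (hopen.mem_nhds hat)).continuousWithinAt

theorem continuous_theta_exp (I : (FractionalIdeal (𝓞 K)⁰ K)ˣ) :
    Continuous fun p : ℝ × (Fin (rank K) → ℝ) =>
      theta ((I : FractionalIdeal (𝓞 K)⁰ K) : Set K) (scaledWeight (Real.exp p.1) p.2) := by
  refine (continuousOn_theta I).comp_continuous ?_
    fun p σ => scaledWeight_pos (Real.exp_pos _) _ _
  refine continuous_pi fun σ => ?_
  exact (Real.continuous_exp.comp continuous_fst).mul ((continuous_unitWeight σ).comp continuous_snd)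

/-- The theta series of `I`, averaged over a fundamental domain for the action of the units on the
weights of fixed norm. -/
noncomputable def unitTheta (I : (FractionalIdeal (𝓞 K)⁰ K)ˣ) (y : ℝ) : ℝ :=
  ∫ c in Set.Icc (0 : Fin (rank K) → ℝ) 1,
    theta ((I : FractionalIdeal (𝓞 K)⁰ K) : Set K) (scaledWeight y c)

theorem continuousOn_unitTheta (I : (FractionalIdeal (𝓞 K)⁰ K)ˣ) :
    ContinuousOn (unitTheta I) (Set.Ioi 0) := by
  have h : Continuous fun v : ℝ => unitTheta I (Real.exp v) :=
    continuous_parametric_integral_of_continuous (μ := volume) (continuous_theta_exp I)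
      isCompact_Icc
  have h2 : ContinuousOn (fun y : ℝ => unitTheta I (Real.exp (Real.log y))) (Set.Ioi 0) :=
    h.comp_continuousOn (Real.continuousOn_log.mono fun y hy => (ne_of_gt hy))
  exact h2.congr fun y hy => (congrArg (unitTheta I) (Real.exp_log hy)).symm

theorem theta_scaledWeight_inv (I : (FractionalIdeal (𝓞 K)⁰ K)ˣ) {y : ℝ} (hy : 0 < y)
    (c : Fin (rank K) → ℝ) :
    theta ((I : FractionalIdeal (𝓞 K)⁰ K) : Set K) (scaledWeight (1 / y) c) =
      (latticeVol I)⁻¹ * y ^ ((Module.finrank ℚ K : ℝ) / 2) *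
        theta ((dualIdeal I : FractionalIdeal (𝓞 K)⁰ K) : Set K) (scaledWeight y (-c)) := by
  have hy' : 0 < 1 / y := by positivity
  rw [theta_inversion I (t := scaledWeight (1 / y) c)
    (fun σ => by rw [scaledWeight, scaledWeight, unitWeight_conjugate])
    (scaledWeight_pos hy' c)]
  congr 1
  · have h1 : ∏ σ : K →+* ℂ, scaledWeight (1 / y) c σ = (y ^ Module.finrank ℚ K)⁻¹ := by
      simp only [scaledWeight]
      rw [Finset.prod_mul_distrib, prod_unitWeight, Finset.prod_const, Finset.card_univ,
        Embeddings.card, mul_one, one_div, inv_pow]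
    rw [h1, mul_inv, Real.sqrt_inv, inv_inv, Real.sqrt_eq_rpow, ← Real.rpow_natCast,
      ← Real.rpow_mul hy.le]
    congr 2
    ring
  · congr 1
    funext σ
    rw [Pi.inv_apply, scaledWeight, scaledWeight, unitWeight_neg, mul_inv, one_div, inv_inv]

theorem setIntegral_Icc_neg_of_periodic {κ : Type*} [Fintype κ] {g : (κ → ℝ) → ℝ}
    (hg : ∀ (c : κ → ℝ) (k : κ → ℤ), g (fun i => c i + k i) = g c) :
    ∫ c in Set.Icc (0 : κ → ℝ) 1, g (-c) = ∫ c in Set.Icc (0 : κ → ℝ) 1, g c := by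
  have h1 : ∀ c : κ → ℝ, g (-c) = g (1 - c) := fun c => by
    rw [← hg (-c) (fun _ => 1)]
    congr 1
    funext i
    simp only [Pi.neg_apply, Pi.sub_apply, Pi.one_apply, Int.cast_one]
    ring
  simp_rw [h1]
  have hmp := Measure.measurePreserving_sub_left (volume : Measure (κ → ℝ)) 1
  rw [← hmp.setIntegral_preimage_emb (MeasurableEquiv.subLeft (1 : κ → ℝ)).measurableEmbedding g]
  congr 2
  ext c
  simp

/-- The theta functional equation in one variable. Inversion of the weights sends `c` to `-c`, which
does not change the average over a period. -/
theorem unitTheta_inv (I : (FractionalIdeal (𝓞 K)⁰ K)ˣ) {y : ℝ} (hy : 0 < y) :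
    unitTheta I (1 / y) = (latticeVol I)⁻¹ * y ^ ((Module.finrank ℚ K : ℝ) / 2) *
      unitTheta (dualIdeal I) y := by
  unfold unitTheta
  simp_rw [theta_scaledWeight_inv I hy]
  rw [integral_const_mul, setIntegral_Icc_neg_of_periodic
    (g := fun c => theta ((dualIdeal I : FractionalIdeal (𝓞 K)⁰ K) : Set K) (scaledWeight y c))
    fun c k => theta_scaledWeight_add_int _ y c k]

end UnitTheta

end DedekindNorthcott

namespace DedekindNorthcott

open MeasureTheory Real NumberField
open scoped nonZeroDivisors

/-! ### Completed partial zeta functions -/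

section FEPair

variable {K : Type*} [Field K] [NumberField K]

open NumberField.Units Filter Asymptotics

/-- The nonzero elements of a fractional ideal. -/
def nonzeroElements (I : (FractionalIdeal (𝓞 K)⁰ K)ˣ) : Set K :=
  {x | x ∈ (I : FractionalIdeal (𝓞 K)⁰ K) ∧ x ≠ 0}

theorem mem_nonzeroElements {I : (FractionalIdeal (𝓞 K)⁰ K)ˣ} {x : K} :
    x ∈ nonzeroElements I ↔ x ∈ ((I : FractionalIdeal (𝓞 K)⁰ K) : Set K) ∧ x ≠ 0 := Iff.rfl

theorem theta_eq_one_add (I : (FractionalIdeal (𝓞 K)⁰ K)ˣ) {t : (K →+* ℂ) → ℝ} {a : ℝ}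
    (ha : 0 < a) (ht : ∀ σ, a ≤ t σ) :
    theta ((I : FractionalIdeal (𝓞 K)⁰ K) : Set K) t = 1 + theta (nonzeroElements I) t := by
  classical
  have hs := summable_theta I ha ht
  unfold theta
  rw [tsum_subtype ((I : FractionalIdeal (𝓞 K)⁰ K) : Set K)
    (fun x => Real.exp (-π * embForm t x)),
    tsum_subtype (nonzeroElements I) (fun x => Real.exp (-π * embForm t x))]
  rw [((summable_subtype_iff_indicator (f := fun x => Real.exp (-π * embForm t x))).mp
    hs).tsum_eq_add_tsum_ite 0]
  congr 1
  · rw [Set.indicator_of_mem]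
    · simp [embForm_zero]
    · exact (I : FractionalIdeal (𝓞 K)⁰ K).zero_mem
  · refine tsum_congr fun x => ?_
    by_cases hx : x = 0
    · simp [hx, nonzeroElements]
    · simp only [hx, if_false, Set.indicator, nonzeroElements, Set.mem_ofPred_eq, ne_eq,
        not_false_eq_true, and_true]
      rfl

theorem exists_unitWeight_lower_bound :
    ∃ a > 0, ∀ c ∈ Set.Icc (0 : Fin (rank K) → ℝ) 1, ∀ σ : K →+* ℂ, a ≤ unitWeight c σ := by
  refine ⟨Real.exp (-∑ σ : K →+* ℂ, ∑ i, |2 * Real.log ‖σ (fundSystem K i : K)‖|),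
    Real.exp_pos _, fun c hc σ => Real.exp_le_exp.mpr ?_⟩
  have h1 := Finset.single_le_sum
    (f := fun σ : K →+* ℂ => ∑ i, |2 * Real.log ‖σ (fundSystem K i : K)‖|)
    (fun σ _ => Finset.sum_nonneg fun i _ => abs_nonneg _) (Finset.mem_univ σ)
  have h2 : -∑ i, |2 * Real.log ‖σ (fundSystem K i : K)‖| ≤
      ∑ i, c i * (2 * Real.log ‖σ (fundSystem K i : K)‖) := by
    rw [← Finset.sum_neg_distrib]
    refine Finset.sum_le_sum fun i _ => ?_
    have h3 : |c i * (2 * Real.log ‖σ (fundSystem K i : K)‖)| ≤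
        |2 * Real.log ‖σ (fundSystem K i : K)‖| := by
      rw [abs_mul]
      refine mul_le_of_le_one_left (abs_nonneg _) ?_
      rw [abs_of_nonneg (hc.1 i)]
      exact hc.2 i
    exact (abs_le.mp h3).1
  exact (neg_le_neg h1).trans h2

theorem theta_scaledWeight_eq_one_add (I : (FractionalIdeal (𝓞 K)⁰ K)ˣ) {y : ℝ} (hy : 0 < y)
    (c : Fin (rank K) → ℝ) :
    theta ((I : FractionalIdeal (𝓞 K)⁰ K) : Set K) (scaledWeight y c) =
      1 + theta (nonzeroElements I) (scaledWeight y c) := by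
  obtain ⟨σ₀, hσ₀⟩ := Finite.exists_min (scaledWeight y c)
  exact theta_eq_one_add I (scaledWeight_pos hy c σ₀) hσ₀

theorem integrableOn_theta_scaledWeight (I : (FractionalIdeal (𝓞 K)⁰ K)ˣ) {y : ℝ} (hy : 0 < y) :
    IntegrableOn (fun c => theta ((I : FractionalIdeal (𝓞 K)⁰ K) : Set K) (scaledWeight y c))
      (Set.Icc (0 : Fin (rank K) → ℝ) 1) := by
  refine Continuous.integrableOn_Icc ?_
  have h := (continuous_theta_exp I).comp
    (Continuous.prodMk (continuous_const (y := Real.log y)) continuous_id)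
  simpa only [Function.comp_def, Real.exp_log hy, id] using h

theorem volume_real_unitCube (κ : Type*) [Fintype κ] :
    (volume : Measure (κ → ℝ)).real (Set.Icc 0 1) = 1 := by
  rw [measureReal_def, Real.volume_Icc_pi]
  simp

theorem unitTheta_sub_one (I : (FractionalIdeal (𝓞 K)⁰ K)ˣ) {y : ℝ} (hy : 0 < y) :
    unitTheta I y - 1 = ∫ c in Set.Icc (0 : Fin (rank K) → ℝ) 1,
      theta (nonzeroElements I) (scaledWeight y c) := by
  have h1 : ∀ c : Fin (rank K) → ℝ, theta (nonzeroElements I) (scaledWeight y c) =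
      theta ((I : FractionalIdeal (𝓞 K)⁰ K) : Set K) (scaledWeight y c) - 1 := fun c => by
    rw [theta_scaledWeight_eq_one_add I hy]; ring
  simp_rw [h1]
  rw [integral_sub (integrableOn_theta_scaledWeight I hy)
    (integrableOn_const isCompact_Icc.measure_lt_top.ne), setIntegral_const, volume_real_unitCube,
    one_smul, unitTheta]

theorem summable_nonzeroElements {I : (FractionalIdeal (𝓞 K)⁰ K)ˣ} {f : K → ℝ}
    (hf : Summable fun x : ((I : FractionalIdeal (𝓞 K)⁰ K) : Set K) => f x) :
    Summable fun x : nonzeroElements I => f x :=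
  hf.comp_injective (i := fun x : nonzeroElements I =>
    (⟨x, (mem_nonzeroElements.mp x.2).1⟩ : ((I : FractionalIdeal (𝓞 K)⁰ K) : Set K))) fun x y hxy => by
      simpa [Subtype.ext_iff] using hxy

/-- Without the term of `0`, the theta series decays exponentially, uniformly over the unit cube. -/
theorem exists_theta_nonzeroElements_le (I : (FractionalIdeal (𝓞 K)⁰ K)ˣ) :
    ∃ a > 0, ∃ C, ∀ y, 1 ≤ y → ∀ c ∈ Set.Icc (0 : Fin (rank K) → ℝ) 1,
      theta (nonzeroElements I) (scaledWeight y c) ≤ C * Real.exp (-a * y) := by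
  obtain ⟨b, hb, hbw⟩ := exists_unitWeight_lower_bound (K := K)
  obtain ⟨δ, hδ, hgap⟩ := exists_form_gap I
  have hs : Summable fun x : nonzeroElements I =>
      Real.exp (-π * (b * embForm (fun _ => 1) (x : K))) :=
    summable_nonzeroElements (f := fun x => Real.exp (-π * (b * embForm (fun _ => 1) x)))
      (summable_theta_const I hb)
  refine ⟨π * b * δ, by positivity, Real.exp (π * b * δ) * ∑' x : nonzeroElements I,
    Real.exp (-π * (b * embForm (fun _ => 1) (x : K))), fun y hy c hc => ?_⟩
  have hterm : ∀ x : nonzeroElements I, Real.exp (-π * embForm (scaledWeight y c) (x : K)) ≤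
      Real.exp (π * b * δ) * Real.exp (-(π * b * δ) * y) *
        Real.exp (-π * (b * embForm (fun _ => 1) (x : K))) := by
    intro x
    rw [← Real.exp_add, ← Real.exp_add]
    refine Real.exp_le_exp.mpr ?_
    have h1 : embForm (fun _ => y * b) (x : K) ≤ embForm (scaledWeight y c) (x : K) :=
      embForm_mono (fun σ => mul_le_mul_of_nonneg_left (hbw c hc σ) (by linarith)) _
    rw [embForm_const] at h1
    have h2 := mul_le_mul_of_nonneg_left h1 pi_pos.le
    -- `y q ≥ q + (y - 1) δ` for `q ≥ δ` and `y ≥ 1`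
    have h3 := mul_le_mul_of_nonneg_left (hgap x (mem_nonzeroElements.mp x.2).1 (mem_nonzeroElements.mp x.2).2)
      (mul_nonneg (mul_nonneg pi_pos.le hb.le) (sub_nonneg.mpr hy))
    linarith
  have hle : ∑' x : nonzeroElements I, Real.exp (-π * embForm (scaledWeight y c) (x : K)) ≤
      ∑' x : nonzeroElements I, Real.exp (π * b * δ) * Real.exp (-(π * b * δ) * y) *
        Real.exp (-π * (b * embForm (fun _ => 1) (x : K))) :=
    Summable.tsum_le_tsum hterm ((hs.mul_left _).of_nonneg_of_le (fun x => (Real.exp_pos _).le)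
      hterm) (hs.mul_left _)
  rw [tsum_mul_left] at hle
  unfold theta
  linarith

theorem theta_nonneg (S : Set K) (t : (K →+* ℂ) → ℝ) : 0 ≤ theta S t :=
  tsum_nonneg fun _ => (Real.exp_pos _).le

theorem unitTheta_sub_one_isBigO (I : (FractionalIdeal (𝓞 K)⁰ K)ˣ) (r : ℝ) :
    (fun y => (unitTheta I y : ℂ) - 1) =O[atTop] fun y : ℝ => y ^ r := by
  obtain ⟨a, ha, C, hC⟩ := exists_theta_nonzeroElements_le I
  refine IsBigO.trans (IsBigO.of_bound C ?_) (isLittleO_exp_neg_mul_rpow_atTop ha r).isBigO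
  filter_upwards [eventually_ge_atTop 1] with y hy
  have hy0 : 0 < y := by linarith
  rw [← Complex.ofReal_one, ← Complex.ofReal_sub, Complex.norm_real, unitTheta_sub_one I hy0]
  refine (norm_setIntegral_le_of_norm_le_const isCompact_Icc.measure_lt_top fun c hc => ?_).trans
    (by rw [volume_real_unitCube, mul_one])
  rw [Real.norm_eq_abs, Real.norm_eq_abs, Real.abs_exp, abs_of_nonneg (theta_nonneg _ _)]
  exact hC y hy c hc

/-- The averaged theta series of `I` and of its dual form a pair to which the Mellin transform
method applies. -/
noncomputable def thetaFEPair (I : (FractionalIdeal (𝓞 K)⁰ K)ˣ) : WeakFEPair ℂ where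
  f y := unitTheta I y
  g y := unitTheta (dualIdeal I) y
  k := (Module.finrank ℚ K : ℝ) / 2
  ε := ((latticeVol I)⁻¹ : ℝ)
  f₀ := 1
  g₀ := 1
  hf_int := (Complex.continuous_ofReal.comp_continuousOn
    (continuousOn_unitTheta I)).locallyIntegrableOn measurableSet_Ioi
  hg_int := (Complex.continuous_ofReal.comp_continuousOn
    (continuousOn_unitTheta (dualIdeal I))).locallyIntegrableOn measurableSet_Ioi
  hk := half_pos (Nat.cast_pos.mpr Module.finrank_pos)
  hε := Complex.ofReal_ne_zero.mpr (inv_ne_zero (latticeVol_pos I).ne')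
  h_feq y hy := by
    rw [unitTheta_inv I hy, smul_eq_mul]
    push_cast
    ring
  hf_top r := unitTheta_sub_one_isBigO I r
  hg_top r := unitTheta_sub_one_isBigO (dualIdeal I) r

/-- The completed partial zeta function of `I`, as the continued Mellin transform of the averaged
theta series, in the variable in which the functional equation reads `s ↔ 1 - s`. -/
noncomputable def completedZeta (I : (FractionalIdeal (𝓞 K)⁰ K)ˣ) (s : ℂ) : ℂ :=
  (thetaFEPair I).Λ (Module.finrank ℚ K * s / 2)

theorem completedZeta_eq_mellin (I : (FractionalIdeal (𝓞 K)⁰ K)ˣ) {s : ℂ} (hs : 1 < s.re) :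
    completedZeta I s =
      mellin (fun y => ((unitTheta I y - 1 : ℝ) : ℂ)) (Module.finrank ℚ K * s / 2) := by
  have hn : (0 : ℝ) < Module.finrank ℚ K := Nat.cast_pos.mpr Module.finrank_pos
  have h : (thetaFEPair I).k < (Module.finrank ℚ K * s / 2 : ℂ).re := by
    have h1 : (Module.finrank ℚ K * s / 2 : ℂ).re = Module.finrank ℚ K * s.re / 2 := by
      rw [show (Module.finrank ℚ K * s / 2 : ℂ) = ((Module.finrank ℚ K / 2 : ℝ) : ℂ) * s by
        push_cast; ring, Complex.re_ofReal_mul]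
      ring
    rw [h1]
    change (Module.finrank ℚ K : ℝ) / 2 < _
    nlinarith
  rw [completedZeta, ← ((thetaFEPair I).hasMellin h).2]
  simp only [Complex.ofReal_sub, Complex.ofReal_one]
  rfl

/-- The functional equation relating `I` at `1 - s` with its dual at `s`, where the dual side is given
by a convergent Mellin transform. -/
theorem completedZeta_one_sub (I : (FractionalIdeal (𝓞 K)⁰ K)ˣ) {s : ℂ} (hs : 1 < s.re) :
    completedZeta I (1 - s) = (latticeVol I)⁻¹ *
      mellin (fun y => ((unitTheta (dualIdeal I) y - 1 : ℝ) : ℂ)) (Module.finrank ℚ K * s / 2) := by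
  have hn : (0 : ℝ) < Module.finrank ℚ K := Nat.cast_pos.mpr Module.finrank_pos
  have h : (thetaFEPair I).symm.k < (Module.finrank ℚ K * s / 2 : ℂ).re := by
    have h1 : (Module.finrank ℚ K * s / 2 : ℂ).re = Module.finrank ℚ K * s.re / 2 := by
      rw [show (Module.finrank ℚ K * s / 2 : ℂ) = ((Module.finrank ℚ K / 2 : ℝ) : ℂ) * s by
        push_cast; ring, Complex.re_ofReal_mul]
      ring
    rw [h1]
    change (Module.finrank ℚ K : ℝ) / 2 < _
    nlinarith
  have h2 := (thetaFEPair I).functional_equation (Module.finrank ℚ K * s / 2)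
  have h3 : ((thetaFEPair I).k : ℂ) - Module.finrank ℚ K * s / 2 =
      Module.finrank ℚ K * (1 - s) / 2 := by
    change (((Module.finrank ℚ K : ℝ) / 2 : ℝ) : ℂ) - _ = _
    push_cast
    ring
  rw [h3] at h2
  rw [completedZeta, h2, ← ((thetaFEPair I).symm.hasMellin h).2, smul_eq_mul]
  simp only [Complex.ofReal_sub, Complex.ofReal_one]
  rfl

theorem meromorphic_completedZeta (I : (FractionalIdeal (𝓞 K)⁰ K)ˣ) :
    Meromorphic (completedZeta I) := by
  have hd : Differentiable ℂ fun s : ℂ => (thetaFEPair I).Λ₀ (Module.finrank ℚ K * s / 2) :=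
    (thetaFEPair I).differentiable_Λ₀.comp (by fun_prop)
  have hm : ∀ f : ℂ → ℂ, Differentiable ℂ f → Meromorphic f :=
    fun f hf z => (hf.analyticAt z).meromorphicAt
  intro z
  unfold completedZeta WeakFEPair.Λ
  refine ((hm _ hd z).sub ?_).sub ?_
  · exact ((MeromorphicAt.const 1 z).div (hm _ (by fun_prop) z)).smul (MeromorphicAt.const _ z)
  · exact ((MeromorphicAt.const _ z).div (hm _ (by fun_prop) z)).smul (MeromorphicAt.const _ z)

end FEPair

end DedekindNorthcott

namespace DedekindNorthcott

open MeasureTheory Real NumberField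
open scoped nonZeroDivisors

/-! ### Nonzero elements of a fractional ideal and integral ideals in a class -/

section Elements

variable {K : Type*} [Field K] [NumberField K]

open NumberField.Units FractionalIdeal

/-- The nonzero integral ideals in the ideal class `C`. -/
abbrev IdealsInClass (C : ClassGroup (𝓞 K)) : Type _ :=
  {J : (Ideal (𝓞 K))⁰ // ClassGroup.mk0 J = C}

theorem exists_generator (I : (FractionalIdeal (𝓞 K)⁰ K)ˣ)
    (J : IdealsInClass (ClassGroup.mk K I)⁻¹) :
    ∃ x : K, ((J : (Ideal (𝓞 K))⁰) : FractionalIdeal (𝓞 K)⁰ K) *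
      (I : FractionalIdeal (𝓞 K)⁰ K) = spanSingleton (𝓞 K)⁰ x := by
  have h : ClassGroup.mk K (FractionalIdeal.mk0 K J.1 * I) = 1 := by
    rw [map_mul, ClassGroup.mk_mk0, J.2, inv_mul_cancel]
  have hp := ClassGroup.mk_eq_one_iff.mp h
  refine ⟨Submodule.IsPrincipal.generator
    ((FractionalIdeal.mk0 K J.1 * I : (FractionalIdeal (𝓞 K)⁰ K)ˣ) : Submodule (𝓞 K) K), ?_⟩
  rw [← eq_spanSingleton_of_principal]
  rfl

/-- A generator of the principal fractional ideal `J I`, for an integral ideal `J` in the class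
inverse to that of `I`. -/
noncomputable def idealGen (I : (FractionalIdeal (𝓞 K)⁰ K)ˣ)
    (J : IdealsInClass (ClassGroup.mk K I)⁻¹) : K := (exists_generator I J).choose

theorem idealGen_spec (I : (FractionalIdeal (𝓞 K)⁰ K)ˣ) (J : IdealsInClass (ClassGroup.mk K I)⁻¹) :
    ((J : (Ideal (𝓞 K))⁰) : FractionalIdeal (𝓞 K)⁰ K) *
      (I : FractionalIdeal (𝓞 K)⁰ K) =
      spanSingleton (𝓞 K)⁰ (idealGen I J) := (exists_generator I J).choose_spec

theorem idealGen_ne_zero (I : (FractionalIdeal (𝓞 K)⁰ K)ˣ)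
    (J : IdealsInClass (ClassGroup.mk K I)⁻¹) : idealGen I J ≠ 0 := by
  intro h
  have h1 := idealGen_spec I J
  rw [h, spanSingleton_zero] at h1
  exact (mul_ne_zero (coeIdeal_ne_zero.mpr (nonZeroDivisors.coe_ne_zero J.1)) I.ne_zero) h1

theorem spanSingleton_mul_unit (x : K) (u : (𝓞 K)ˣ) :
    spanSingleton (𝓞 K)⁰ (x * (u : K)) = spanSingleton (𝓞 K)⁰ x := by
  rw [← spanSingleton_mul_spanSingleton]
  have : spanSingleton (𝓞 K)⁰ (u : K) = 1 := by
    rw [← coeIdeal_span_singleton, Ideal.span_singleton_eq_top.mpr u.isUnit, coeIdeal_top]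
  rw [this, mul_one]

/-- Two generators of a principal fractional ideal differ by a unit. -/
theorem exists_unit_of_spanSingleton_eq {x y : K} (hx : x ≠ 0)
    (h : spanSingleton (𝓞 K)⁰ x = spanSingleton (𝓞 K)⁰ y) : ∃ u : (𝓞 K)ˣ, y = x * (u : K) := by
  have hy : y ≠ 0 := by
    rintro rfl
    rw [spanSingleton_zero] at h
    exact hx (spanSingleton_eq_zero_iff.mp h)
  have h1 : y ∈ spanSingleton (𝓞 K)⁰ x := h ▸ mem_spanSingleton_self _ y
  have h2 : x ∈ spanSingleton (𝓞 K)⁰ y := h ▸ mem_spanSingleton_self _ x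
  obtain ⟨a, ha⟩ := (mem_spanSingleton _).mp h1
  obtain ⟨b, hb⟩ := (mem_spanSingleton _).mp h2
  rw [Algebra.smul_def] at ha hb
  have hab : a * b = 1 := by
    apply IsFractionRing.injective (𝓞 K) K
    rw [map_mul, map_one]
    apply mul_right_cancel₀ hy
    rw [one_mul, mul_assoc, hb, ha]
  exact ⟨Units.mkOfMulEqOne a b hab, by rw [mul_comm]; exact ha.symm⟩

/-- The element of `I` with the given integral ideal, root of unity and unit exponents. -/
noncomputable def elementOf (I : (FractionalIdeal (𝓞 K)⁰ K)ˣ)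
    (p : (IdealsInClass (ClassGroup.mk K I)⁻¹ × torsion K) × (Fin (rank K) → ℤ)) : K :=
  idealGen I p.1.1 * ((p.1.2 : (𝓞 K)ˣ) : K) * (fundUnit p.2 : K)

theorem elementOf_eq (I : (FractionalIdeal (𝓞 K)⁰ K)ˣ)
    (p : (IdealsInClass (ClassGroup.mk K I)⁻¹ × torsion K) × (Fin (rank K) → ℤ)) :
    elementOf I p = idealGen I p.1.1 * (((p.1.2 : (𝓞 K)ˣ) * fundUnit p.2 : (𝓞 K)ˣ) : K) := by
  rw [elementOf, mul_assoc, ← Units.coe_mul]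

theorem spanSingleton_elementOf (I : (FractionalIdeal (𝓞 K)⁰ K)ˣ)
    (p : (IdealsInClass (ClassGroup.mk K I)⁻¹ × torsion K) × (Fin (rank K) → ℤ)) :
    spanSingleton (𝓞 K)⁰ (elementOf I p) =
      ((p.1.1 : (Ideal (𝓞 K))⁰) : FractionalIdeal (𝓞 K)⁰ K) *
        (I : FractionalIdeal (𝓞 K)⁰ K) := by
  rw [elementOf_eq, spanSingleton_mul_unit, idealGen_spec]

theorem elementOf_mem (I : (FractionalIdeal (𝓞 K)⁰ K)ˣ)
    (p : (IdealsInClass (ClassGroup.mk K I)⁻¹ × torsion K) × (Fin (rank K) → ℤ)) :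
    elementOf I p ∈ nonzeroElements I := by
  refine mem_nonzeroElements.mpr ⟨?_, ?_⟩
  · have h1 : spanSingleton (𝓞 K)⁰ (elementOf I p) ≤ I := by
      rw [spanSingleton_elementOf]
      exact mul_le_of_le_one_left' coeIdeal_le_one
    exact spanSingleton_le_iff_mem.mp h1
  · rw [elementOf_eq]
    exact mul_ne_zero (idealGen_ne_zero I _) (coe_ne_zero _)

theorem elementOf_injective (I : (FractionalIdeal (𝓞 K)⁰ K)ˣ) :
    Function.Injective (elementOf I) := by
  rintro ⟨⟨J, ζ⟩, k⟩ ⟨⟨J', ζ'⟩, k'⟩ h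
  have h1 : J = J' := by
    have h2 := congrArg (spanSingleton (𝓞 K)⁰) h
    rw [spanSingleton_elementOf, spanSingleton_elementOf] at h2
    have h3 := mul_right_cancel₀ I.ne_zero h2
    exact Subtype.ext (Subtype.ext (coeIdeal_injective h3))
  subst h1
  rw [elementOf_eq, elementOf_eq] at h
  have h4 := mul_left_cancel₀ (idealGen_ne_zero I J) h
  have h5 := coe_injective K h4
  have h6 := (exist_unique_eq_mul_prod K ((ζ : (𝓞 K)ˣ) * fundUnit k)).unique
    (y₁ := (ζ, k)) (y₂ := (ζ', k')) rfl h5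
  rw [Prod.mk.injEq] at h6
  rw [h6.1, h6.2]

theorem elementOf_surjective (I : (FractionalIdeal (𝓞 K)⁰ K)ˣ) {x : K}
    (hx : x ∈ nonzeroElements I) : ∃ p, elementOf I p = x := by
  obtain ⟨hxI, hx0⟩ := mem_nonzeroElements.mp hx
  have h1 : spanSingleton (𝓞 K)⁰ x * (I⁻¹ : (FractionalIdeal (𝓞 K)⁰ K)ˣ) ≤ 1 := by
    rw [← I.mul_inv]
    exact mul_le_mul_left (spanSingleton_le_iff_mem.mpr hxI) _
  obtain ⟨J, hJ⟩ := le_one_iff_exists_coeIdeal.mp h1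
  have hJI : (J : FractionalIdeal (𝓞 K)⁰ K) *
      (I : FractionalIdeal (𝓞 K)⁰ K) = spanSingleton (𝓞 K)⁰ x := by
    rw [hJ, mul_assoc, Units.inv_mul, mul_one]
  have hJ0 : J ≠ ⊥ := by
    rintro rfl
    rw [coeIdeal_bot, zero_mul] at hJI
    exact hx0 (spanSingleton_eq_zero_iff.mp hJI.symm)
  have hJmem : J ∈ (Ideal (𝓞 K))⁰ := mem_nonZeroDivisors_iff_ne_zero.mpr hJ0
  have hclass : ClassGroup.mk0 ⟨J, hJmem⟩ = (ClassGroup.mk K I)⁻¹ := by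
    rw [eq_inv_iff_mul_eq_one, ← ClassGroup.mk_mk0 K, ← map_mul, ClassGroup.mk_eq_one_iff]
    refine ⟨⟨x, ?_⟩⟩
    rw [Units.val_mul, FractionalIdeal.coe_mk0, hJI, coe_spanSingleton]
  set J' : IdealsInClass (ClassGroup.mk K I)⁻¹ := ⟨⟨J, hJmem⟩, hclass⟩
  have h2 : spanSingleton (𝓞 K)⁰ (idealGen I J') = spanSingleton (𝓞 K)⁰ x := by
    rw [← idealGen_spec, ← hJI]
  obtain ⟨u, hu⟩ := exists_unit_of_spanSingleton_eq (idealGen_ne_zero I J') h2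
  obtain ⟨⟨ζ, k⟩, hζ, -⟩ := exist_unique_eq_mul_prod K u
  refine ⟨((J', ζ), k), ?_⟩
  rw [elementOf_eq, hu, hζ]
  rfl

/-- Nonzero elements of `I` correspond to triples of an integral ideal in the inverse class, a root
of unity and exponents of the fundamental units. -/
noncomputable def elementEquiv (I : (FractionalIdeal (𝓞 K)⁰ K)ˣ) :
    (IdealsInClass (ClassGroup.mk K I)⁻¹ × torsion K) × (Fin (rank K) → ℤ) ≃ nonzeroElements I :=
  Equiv.ofBijective (fun p => ⟨elementOf I p, elementOf_mem I p⟩)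
    ⟨fun _ _ h => elementOf_injective I (congrArg Subtype.val h),
      fun x => (elementOf_surjective I x.2).imp fun _ hp => Subtype.ext hp⟩

theorem abs_norm_idealGen (I : (FractionalIdeal (𝓞 K)⁰ K)ˣ)
    (J : IdealsInClass (ClassGroup.mk K I)⁻¹) :
    |(Algebra.norm ℚ (idealGen I J))| =
      Ideal.absNorm (J : Ideal (𝓞 K)) * absNorm (I : FractionalIdeal (𝓞 K)⁰ K) := by
  rw [← absNorm_span_singleton (R := 𝓞 K), ← idealGen_spec, map_mul, coeIdeal_absNorm]

end Elements

/-! ### Sums over ideals -/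

section IdealSums

variable (K : Type*) [Field K] [NumberField K]

open Filter Asymptotics

theorem lseriesSummable_card_absNorm {s : ℂ} (hs : 1 < s.re) :
    LSeriesSummable (fun n => ((Nat.card {I : Ideal (𝓞 K) // Ideal.absNorm I = n} : ℝ) : ℂ)) s := by
  refine LSeriesSummable_of_sum_norm_bigO_and_nonneg (r := 1) ?_ (fun _ => Nat.cast_nonneg _)
    zero_le_one hs
  have h : Tendsto (fun n : ℕ => (∑ k ∈ Finset.Icc 1 n,
      (Nat.card {I : Ideal (𝓞 K) // Ideal.absNorm I = k} : ℝ)) / (n : ℝ)) atTop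
      (nhds (dedekindZeta_residue K)) := by
    refine ((Ideal.tendsto_norm_le_div_atTop₀ K).comp tendsto_natCast_atTop_atTop).congr fun n => ?_
    simp only [Function.comp_apply, Nat.cast_le, ← Nat.cast_sum]
    congr
    rw [← add_left_inj 1, ← Ideal.card_norm_le_eq_card_norm_le_add_one,
      show Finset.Icc 1 n = Finset.Ioc 0 n from Finset.Icc_succ_left_eq_Ioc _ _,
      show 1 = Nat.card {I : Ideal (𝓞 K) // Ideal.absNorm I = 0} by
        simp [Ideal.absNorm_eq_zero_iff],
      Finset.sum_Ioc_add_eq_sum_Icc (n.zero_le),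
      ← Finset.card_preimage_eq_sum_card_image_eq
        (fun k _ => Ideal.finite_setOfPred_absNorm_eq k)]
    simp [Set.coe_eq_subtype]
  exact isBigO_atTop_natCast_rpow_of_tendsto_div_rpow (by simpa)

theorem summable_absNorm_rpow {σ : ℝ} (hσ : 1 < σ) :
    Summable fun J : Ideal (𝓞 K) => (Ideal.absNorm J : ℝ) ^ (-σ) := by
  rw [← (Equiv.sigmaFiberEquiv fun J : Ideal (𝓞 K) => Ideal.absNorm J).summable_iff]
  rw [summable_sigma_of_nonneg fun _ => by dsimp; positivity]
  have hfib : ∀ n : ℕ, Finite {J : Ideal (𝓞 K) // Ideal.absNorm J = n} :=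
    fun n => (Ideal.finite_setOfPred_absNorm_eq n).to_subtype
  refine ⟨fun n => Summable.of_finite, ?_⟩
  have h := (lseriesSummable_card_absNorm K (s := σ) (by simpa using hσ)).norm
  refine h.congr fun n => ?_
  have h1 : ∀ J : {J : Ideal (𝓞 K) // Ideal.absNorm J = n},
      ((fun J : Ideal (𝓞 K) => (Ideal.absNorm J : ℝ) ^ (-σ)) ∘
        (Equiv.sigmaFiberEquiv fun J : Ideal (𝓞 K) => Ideal.absNorm J)) ⟨n, J⟩ =
        (n : ℝ) ^ (-σ) := fun J => by
    change (Ideal.absNorm J.1 : ℝ) ^ (-σ) = _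
    rw [J.2]
  rw [tsum_congr h1, tsum_const, nsmul_eq_mul]
  rcases eq_or_ne n 0 with rfl | hn
  · have : (-σ) ≠ 0 := by linarith
    simp [Real.zero_rpow this]
  · rw [LSeries.norm_term_eq, if_neg hn, Complex.ofReal_re, Real.rpow_neg (Nat.cast_nonneg _),
      Complex.norm_real, Real.norm_of_nonneg (Nat.cast_nonneg _), div_eq_mul_inv]

theorem summable_absNorm_cpow {s : ℂ} (hs : 1 < s.re) :
    Summable fun J : Ideal (𝓞 K) => (Ideal.absNorm J : ℂ) ^ (-s) := by
  refine Summable.of_norm ((summable_absNorm_rpow K hs).congr fun J => ?_)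
  rw [Complex.norm_natCast_cpow_of_re_ne_zero _ (by rw [Complex.neg_re]; linarith), Complex.neg_re]

/-- The Dedekind zeta function as a sum over all ideals; the zero ideal contributes `0 ^ (-s) = 0`. -/
theorem dedekindZeta_eq_tsum {s : ℂ} (hs : 1 < s.re) :
    dedekindZeta K s = ∑' J : Ideal (𝓞 K), (Ideal.absNorm J : ℂ) ^ (-s) := by
  have hsum := summable_absNorm_cpow K hs
  rw [← (Equiv.sigmaFiberEquiv fun J : Ideal (𝓞 K) => Ideal.absNorm J).summable_iff] at hsum
  rw [← (Equiv.sigmaFiberEquiv fun J : Ideal (𝓞 K) => Ideal.absNorm J).tsum_eq]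
  refine Eq.trans ?_ hsum.tsum_sigma.symm
  refine tsum_congr fun n => ?_
  have h1 : ∀ J : {J : Ideal (𝓞 K) // Ideal.absNorm J = n},
      ((fun J : Ideal (𝓞 K) => (Ideal.absNorm J : ℂ) ^ (-s)) ∘
        (Equiv.sigmaFiberEquiv fun J : Ideal (𝓞 K) => Ideal.absNorm J)) ⟨n, J⟩ =
        (n : ℂ) ^ (-s) := fun J => by
    change (Ideal.absNorm J.1 : ℂ) ^ (-s) = _
    rw [J.2]
  rw [tsum_congr h1, tsum_const, nsmul_eq_mul]
  rcases eq_or_ne n 0 with rfl | hn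
  · have : -s ≠ 0 := by
      intro h
      rw [neg_eq_zero] at h
      rw [h, Complex.zero_re] at hs
      linarith
    simp [Complex.zero_cpow this]
  · rw [LSeries.term_of_ne_zero hn, Complex.cpow_neg, div_eq_mul_inv]

end IdealSums

end DedekindNorthcott

namespace DedekindNorthcott

open MeasureTheory Real NumberField
open scoped nonZeroDivisors

/-! ### Mellin transforms in logarithmic coordinates -/

section Mellin

theorem exp_smul_cpow_sub_one_smul {E : Type*} [NormedAddCommGroup E] [NormedSpace ℂ E]
    (u : ℝ) (z : ℂ) (w : E) :
    |Real.exp u| • ((Real.exp u : ℝ) : ℂ) ^ (z - 1) • w = Complex.exp (z * u) • w := by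
  rw [abs_of_pos (Real.exp_pos u), ← Complex.coe_smul, smul_smul, Complex.ofReal_exp,
    Complex.cpow_def_of_ne_zero (Complex.exp_ne_zero _), Complex.log_exp (by simp [pi_pos])
      (by simpa using pi_nonneg), ← Complex.exp_add]
  congr 2
  ring

/-- The substitution `y = exp u` in a Mellin transform. -/
theorem mellin_eq_integral_exp {E : Type*} [NormedAddCommGroup E] [NormedSpace ℂ E]
    (f : ℝ → E) (z : ℂ) :
    mellin f z = ∫ u : ℝ, Complex.exp (z * u) • f (Real.exp u) := by
  have h := integral_image_eq_integral_abs_deriv_smul (s := Set.univ) MeasurableSet.univ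
    (fun x _ => (Real.hasDerivAt_exp x).hasDerivWithinAt) Real.exp_injective.injOn
    (fun y : ℝ => (y : ℂ) ^ (z - 1) • f y)
  rw [Set.image_univ, Real.range_exp, setIntegral_univ] at h
  rw [mellin, h]
  simp only [exp_smul_cpow_sub_one_smul]

theorem integral_exp_mul_exp_neg_exp {z : ℂ} (hz : 0 < z.re) {q : ℝ} (hq : 0 < q) :
    ∫ u : ℝ, Complex.exp (z * u) * Complex.exp (-(q * Real.exp u : ℝ)) =
      (q : ℂ) ^ (-z) * Complex.Gamma z := by
  have h := mellin_eq_integral_exp (fun y : ℝ => Complex.exp (-(q * y))) z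
  have h2 := Complex.integral_cpow_mul_exp_neg_mul_Ioi hz hq
  rw [mellin] at h
  simp only [smul_eq_mul] at h
  rw [h2] at h
  push_cast
  push_cast at h
  rw [← h, one_div, Complex.inv_cpow_eq_ite, if_neg, Complex.cpow_neg]
  rw [Complex.arg_ofReal_of_nonneg hq.le]
  exact pi_pos.ne

theorem integrable_exp_mul_exp_neg_exp {z : ℂ} (hz : 0 < z.re) {q : ℝ} (hq : 0 < q) :
    Integrable fun u : ℝ => Complex.exp (z * u) * Complex.exp (-(q * Real.exp u : ℝ)) := by
  -- a non-integrable function would have integral `0`, but the Gamma integral does not vanish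
  by_contra h
  have h1 := integral_exp_mul_exp_neg_exp hz hq
  rw [integral_undef h] at h1
  have h2 : (q : ℂ) ^ (-z) ≠ 0 := by
    rw [Complex.cpow_ne_zero_iff]
    exact Or.inl (Complex.ofReal_ne_zero.mpr hq.ne')
  exact mul_ne_zero h2 (Complex.Gamma_ne_zero_of_re_pos hz) h1.symm

end Mellin

/-! ### Integrals over the logarithmic space -/

section PlaceCoordinates

variable {K : Type*} [Field K] [NumberField K]

open NumberField.Units NumberField.Units.dirichletUnitTheorem InfinitePlace

/-- The linear map `(v, c) ↦ (v + ∑_i c_i log |ε_i|_w^2)_w` from `ℝ × ℝ^r` to the logarithmic space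
with one coordinate for every infinite place. -/
noncomputable def placeMap (K : Type*) [Field K] [NumberField K] :
    ℝ × (Fin (rank K) → ℝ) →ₗ[ℝ] (InfinitePlace K → ℝ) where
  toFun p w := p.1 + ∑ i, p.2 i * (2 * Real.log (w (fundSystem K i : K)))
  map_add' p q := by
    funext w
    simp only [Prod.fst_add, Prod.snd_add, Pi.add_apply, add_mul, Finset.sum_add_distrib]
    ring
  map_smul' a p := by
    funext w
    simp only [Prod.smul_fst, Prod.smul_snd, Pi.smul_apply, smul_eq_mul, RingHom.id_apply,
      mul_add, Finset.mul_sum, mul_assoc]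

theorem placeMap_apply (p : ℝ × (Fin (rank K) → ℝ)) (w : InfinitePlace K) :
    placeMap K p w = p.1 + ∑ i, p.2 i * (2 * Real.log (w (fundSystem K i : K))) := rfl

theorem sum_mult_mul_placeMap (p : ℝ × (Fin (rank K) → ℝ)) :
    ∑ w, (mult w : ℝ) * placeMap K p w = Module.finrank ℚ K * p.1 := by
  simp only [placeMap_apply, mul_add, Finset.sum_add_distrib, Finset.mul_sum]
  rw [Finset.sum_comm, ← Finset.sum_mul, ← Nat.cast_sum, sum_mult_eq]
  have h : ∀ i, ∑ w : InfinitePlace K, (mult w : ℝ) *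
      (p.2 i * (2 * Real.log (w (fundSystem K i : K)))) = 0 := fun i => by
    have h1 : ∀ w : InfinitePlace K, (mult w : ℝ) *
      (p.2 i * (2 * Real.log (w (fundSystem K i : K)))) =
        2 * p.2 i * (mult w * Real.log (w (fundSystem K i : K))) := fun w => by ring
    simp_rw [h1]
    rw [← Finset.mul_sum, sum_mult_mul_log, mul_zero]
  simp [h]

/-- The coordinate `v` is recovered by summing over the places, and then `c` by the independence of
the logarithms of the fundamental units. -/
theorem placeMap_injective : Function.Injective (placeMap K) := by
  rw [injective_iff_map_eq_zero]
  intro p hp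
  have hw : ∀ w, placeMap K p w = 0 := fun w => congrFun hp w
  have h1 : p.1 = 0 := by
    have h2 := sum_mult_mul_placeMap p
    simp only [hw, mul_zero, Finset.sum_const_zero] at h2
    have h3 : (Module.finrank ℚ K : ℝ) ≠ 0 := Nat.cast_ne_zero.mpr Module.finrank_pos.ne'
    simpa [h3] using h2.symm
  have h4 := Fintype.linearIndependent_iff.mp (isMaxRank_fundSystem K) p.2 (by
    funext w
    have h5 := hw w.1
    rw [placeMap_apply, h1, zero_add] at h5
    rw [Finset.sum_apply]
    simp only [Pi.smul_apply, logEmbedding_component, smul_eq_mul, Pi.zero_apply]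
    have h6 : ∀ i, p.2 i * (mult w.1 * Real.log (w.1 (fundSystem K i : K))) =
        mult w.1 / 2 * (p.2 i * (2 * Real.log (w.1 (fundSystem K i : K)))) := fun i => by ring
    simp_rw [h6]
    rw [← Finset.mul_sum, h5, mul_zero])
  exact Prod.ext h1 (funext h4)

/-- `placeMap` as a continuous linear equivalence. -/
noncomputable def placeEquiv (K : Type*) [Field K] [NumberField K] :
    (ℝ × (Fin (rank K) → ℝ)) ≃L[ℝ] (InfinitePlace K → ℝ) :=
  (LinearEquiv.ofInjectiveOfFinrankEq (placeMap K) placeMap_injective (by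
    rw [Module.finrank_prod, Module.finrank_self, Module.finrank_fin_fun,
      Module.finrank_fintype_fun_eq_card, rank, add_comm]
    exact Nat.sub_add_cancel Fintype.card_pos)).toContinuousLinearEquiv

instance isAddHaarMeasure_map_placeEquiv :
    (Measure.map (placeEquiv K)
      (volume : Measure (ℝ × (Fin (rank K) → ℝ)))).IsAddHaarMeasure :=
  haveI : (volume : Measure (ℝ × (Fin (rank K) → ℝ))).IsAddHaarMeasure :=
    inferInstanceAs ((volume : Measure ℝ).prod
      (volume : Measure (Fin (rank K) → ℝ))).IsAddHaarMeasure
  (placeEquiv K).isAddHaarMeasure_map volume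

/-- The factor comparing the Lebesgue measures under `placeEquiv`; it is the inverse of a multiple
of the regulator, but only its positivity matters. -/
noncomputable def placeFactor (K : Type*) [Field K] [NumberField K] : NNReal :=
  Measure.addHaarScalarFactor (Measure.map (placeEquiv K) volume) volume

theorem map_placeEquiv_volume :
    Measure.map (placeEquiv K) volume = placeFactor K • volume :=
  Measure.isAddLeftInvariant_eq_smul _ _

theorem placeFactor_pos : 0 < placeFactor K :=
  Measure.addHaarScalarFactor_pos_of_isAddHaarMeasure _ _

theorem integral_comp_placeMap (F : (InfinitePlace K → ℝ) → ℂ) :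
    ∫ p, F (placeMap K p) = placeFactor K * ∫ u, F u := by
  have h := integral_map_equiv (μ := (volume : Measure (ℝ × (Fin (rank K) → ℝ))))
    (placeEquiv K).toHomeomorph.toMeasurableEquiv F
  refine h.symm.trans ?_
  have h2 : Measure.map (placeEquiv K).toHomeomorph.toMeasurableEquiv
      (volume : Measure (ℝ × (Fin (rank K) → ℝ))) = placeFactor K • volume :=
    map_placeEquiv_volume
  rw [h2, integral_smul_nnreal_measure]
  rfl

theorem integrable_comp_placeMap {F : (InfinitePlace K → ℝ) → ℂ} (hF : Integrable F) :
    Integrable fun p => F (placeMap K p) := by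
  have h2 : Measure.map (placeEquiv K).toHomeomorph.toMeasurableEquiv
      (volume : Measure (ℝ × (Fin (rank K) → ℝ))) = placeFactor K • volume :=
    map_placeEquiv_volume
  have h := (integrable_map_equiv (placeEquiv K).toHomeomorph.toMeasurableEquiv F
    (μ := (volume : Measure (ℝ × (Fin (rank K) → ℝ))))).mp (by
      rw [h2]; exact hF.smul_measure_nnreal)
  exact h

/-- A sum over the complex embeddings is a sum over the places, weighted by local degrees. -/
theorem sum_embeddings_comp_mk (g : InfinitePlace K → ℝ) :
    ∑ σ : K →+* ℂ, g (InfinitePlace.mk σ) = ∑ w, mult w * g w := by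
  classical
  rw [← Finset.sum_fiberwise Finset.univ (fun σ : K →+* ℂ => InfinitePlace.mk σ)]
  refine Finset.sum_congr rfl fun w _ => ?_
  rw [Finset.sum_congr rfl (g := fun _ => g w) fun σ hσ => by rw [(Finset.mem_filter.mp hσ).2],
    Finset.sum_const, card_filter_mk_eq, nsmul_eq_mul]

/-- In the logarithmic coordinates, the quadratic form is a sum of functions of one coordinate each. -/
theorem embForm_scaledWeight_exp (p : ℝ × (Fin (rank K) → ℝ)) (x : K) :
    embForm (scaledWeight (Real.exp p.1) p.2) x =
      ∑ w : InfinitePlace K, mult w * (Real.exp (placeMap K p w) * w x ^ 2) := by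
  rw [← sum_embeddings_comp_mk fun w => Real.exp (placeMap K p w) * w x ^ 2]
  refine Finset.sum_congr rfl fun σ _ => ?_
  simp only [scaledWeight, unitWeight, placeMap_apply, InfinitePlace.apply, Real.exp_add]

/-- The term of the Mellin transform of the averaged theta series attached to `x ∈ K`, in
logarithmic coordinates. -/
noncomputable def mellinTerm (s : ℂ) (x : K) (p : ℝ × (Fin (rank K) → ℝ)) : ℂ :=
  Complex.exp (Module.finrank ℚ K * s / 2 * p.1) *
    (Real.exp (-π * embForm (scaledWeight (Real.exp p.1) p.2) x) : ℝ)

theorem mellinTerm_eq_prod (s : ℂ) (x : K) (p : ℝ × (Fin (rank K) → ℝ)) :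
    mellinTerm s x p = ∏ w : InfinitePlace K, (Complex.exp (mult w * s / 2 * placeMap K p w) *
      Complex.exp (-(π * mult w * w x ^ 2 * Real.exp (placeMap K p w) : ℝ))) := by
  rw [Finset.prod_mul_distrib, ← Complex.exp_sum, ← Complex.exp_sum, mellinTerm]
  congr 2
  · have h := congrArg (fun r : ℝ => (r : ℂ)) (sum_mult_mul_placeMap p)
    push_cast at h
    calc (Module.finrank ℚ K * s / 2 * p.1 : ℂ) = s / 2 * (Module.finrank ℚ K * p.1) := by ring
      _ = _ := by
        rw [← h, Finset.mul_sum]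
        exact Finset.sum_congr rfl fun w _ => by ring
  · rw [Complex.ofReal_exp, embForm_scaledWeight_exp]
    congr 1
    push_cast
    rw [Finset.mul_sum]
    exact Finset.sum_congr rfl fun w _ => by ring

/-- The product of the Gamma factors of `K`. -/
noncomputable def gammaFactor (K : Type*) [Field K] [NumberField K] (s : ℂ) : ℂ :=
  ∏ w : InfinitePlace K, ((π * mult w : ℝ) : ℂ) ^ (-(mult w * s / 2)) *
    Complex.Gamma (mult w * s / 2)

omit [NumberField K] in
theorem re_mult_mul_pos {s : ℂ} (hs : 0 < s.re) (w : InfinitePlace K) :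
    0 < (mult w * s / 2 : ℂ).re := by
  have h : (mult w * s / 2 : ℂ) = ((mult w / 2 : ℝ) : ℂ) * s := by push_cast; ring
  rw [h, Complex.re_ofReal_mul]
  exact mul_pos (half_pos (Nat.cast_pos.mpr mult_pos)) hs

theorem integrable_mellinTerm {s : ℂ} (hs : 0 < s.re) {x : K} (hx : x ≠ 0) :
    Integrable (mellinTerm s x) := by
  have h := integrable_comp_placeMap (K := K) (Integrable.fintype_prod_dep
    (f := fun (w : InfinitePlace K) (u : ℝ) => Complex.exp (mult w * s / 2 * u) *
      Complex.exp (-(π * mult w * w x ^ 2 * Real.exp u : ℝ))) (μ := fun _ => volume) fun w =>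
    integrable_exp_mul_exp_neg_exp (re_mult_mul_pos hs w) (by
      have h1 : 0 < w x := pos_iff.mpr hx
      have h2 : (0 : ℝ) < mult w := Nat.cast_pos.mpr mult_pos
      positivity))
  exact h.congr (ae_of_all _ fun p => (mellinTerm_eq_prod s x p).symm)

theorem cpow_place_factor (m : ℕ) {a : ℝ} (ha : 0 < a) (hm : 0 < m) (s : ℂ) :
    ((π * m * a ^ 2 : ℝ) : ℂ) ^ (-(m * s / 2)) =
      ((π * m : ℝ) : ℂ) ^ (-(m * s / 2)) * Complex.exp (-s * Real.log (a ^ m)) := by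
  have hm' : (0 : ℝ) < m := Nat.cast_pos.mpr hm
  have h1 : (0 : ℝ) < π * m := mul_pos pi_pos hm'
  have h2 : (0 : ℝ) < π * m * a ^ 2 := mul_pos h1 (pow_pos ha 2)
  rw [Complex.cpow_def_of_ne_zero (Complex.ofReal_ne_zero.mpr h2.ne'),
    Complex.cpow_def_of_ne_zero (Complex.ofReal_ne_zero.mpr h1.ne'), ← Complex.exp_add,
    ← Complex.ofReal_log h1.le, ← Complex.ofReal_log h2.le,
    Real.log_mul h1.ne' (pow_pos ha 2).ne', Real.log_pow, Real.log_pow]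
  congr 1
  push_cast
  ring

/-- The Mellin term of `x` integrates to the Gamma factors times `|N(x)|^(-s)`. -/
theorem integral_mellinTerm {s : ℂ} (hs : 0 < s.re) {x : K} (hx : x ≠ 0) :
    ∫ p, mellinTerm s x p =
      placeFactor K * gammaFactor K s * ((|Algebra.norm ℚ x| : ℚ) : ℂ) ^ (-s) := by
  simp_rw [mellinTerm_eq_prod]
  rw [integral_comp_placeMap (fun u => ∏ w : InfinitePlace K,
    (Complex.exp (mult w * s / 2 * u w) *
      Complex.exp (-(π * mult w * w x ^ 2 * Real.exp (u w) : ℝ)))),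
    integral_fintype_prod_volume_eq_prod (fun (w : InfinitePlace K) (u : ℝ) =>
      (Complex.exp (mult w * s / 2 * u) *
      Complex.exp (-(π * mult w * w x ^ 2 * Real.exp u : ℝ)))), mul_assoc]
  congr 1
  have hpos : ∀ w : InfinitePlace K, 0 < w x := fun w => pos_iff.mpr hx
  have h1 : ∀ w : InfinitePlace K, ∫ u : ℝ, (Complex.exp (mult w * s / 2 * u) *
      Complex.exp (-(π * mult w * w x ^ 2 * Real.exp u : ℝ))) =
      ((π * mult w : ℝ) : ℂ) ^ (-(mult w * s / 2)) * Complex.Gamma (mult w * s / 2) *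
        Complex.exp (-s * Real.log (w x ^ mult w)) := fun w => by
    have h2 : (0 : ℝ) < mult w := Nat.cast_pos.mpr mult_pos
    have h3 := hpos w
    rw [integral_exp_mul_exp_neg_exp (re_mult_mul_pos hs w) (by positivity),
      cpow_place_factor _ h3 mult_pos]
    ring
  simp_rw [h1]
  rw [Finset.prod_mul_distrib, gammaFactor, ← Complex.exp_sum, ← Finset.mul_sum,
    ← Complex.ofReal_sum, ← Real.log_prod fun w _ => (pow_pos (hpos w) _).ne', prod_eq_abs_norm]
  congr 1
  have h4 : (0 : ℚ) < |Algebra.norm ℚ x| := abs_pos.mpr (Algebra.norm_ne_zero_iff.mpr hx)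
  have h5 : (0 : ℝ) < (|Algebra.norm ℚ x| : ℚ) := by exact_mod_cast h4
  rw [← Complex.ofReal_ratCast, Complex.cpow_def_of_ne_zero (Complex.ofReal_ne_zero.mpr h5.ne'),
    ← Complex.ofReal_log h5.le]
  congr 1
  push_cast
  ring

end PlaceCoordinates

end DedekindNorthcott

namespace DedekindNorthcott

open MeasureTheory Real NumberField
open scoped nonZeroDivisors

/-! ### Unfolding the Mellin transform into a sum over ideals -/

/-- A measurable series of integrable functions with summable `L¹` norms is integrable. -/
theorem integrable_tsum_of_summable_integral_norm {α ι E : Type*} [MeasurableSpace α]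
    {μ : Measure α} [NormedAddCommGroup E] [Countable ι] {F : ι → α → E}
    (hF : ∀ i, Integrable (F i) μ) (hF_sum : Summable fun i => ∫ a, ‖F i a‖ ∂μ)
    (hm : AEStronglyMeasurable (fun a => ∑' i, F i a) μ) :
    Integrable (fun a => ∑' i, F i a) μ := by
  refine ⟨hm, ?_⟩
  have h1 : ∫⁻ a, ‖∑' i, F i a‖ₑ ∂μ ≤ ∫⁻ a, ∑' i, ‖F i a‖ₑ ∂μ :=
    lintegral_mono fun a => enorm_tsum_le_tsum_enorm
  rw [lintegral_tsum fun i => (hF i).1.enorm] at h1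
  refine h1.trans_lt ?_
  have h2 : ∀ i, ∫⁻ a, ‖F i a‖ₑ ∂μ = ENNReal.ofReal (∫ a, ‖F i a‖ ∂μ) := fun i => by
    rw [ofReal_integral_norm_eq_lintegral_enorm (hF i)]
  simp_rw [h2]
  rw [← ENNReal.ofReal_tsum_of_nonneg (fun i => integral_nonneg fun a => norm_nonneg _) hF_sum]
  exact ENNReal.ofReal_lt_top

section Unfolding

variable {K : Type*} [Field K] [NumberField K]

open NumberField.Units FractionalIdeal

/-- The half-open unit cube in the second coordinate. -/
def unitStrip (K : Type*) [Field K] [NumberField K] : Set (ℝ × (Fin (rank K) → ℝ)) :=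
  {p | ∀ i, p.2 i ∈ Set.Ioc (0 : ℝ) (0 + 1)}

/-- The norm of a Mellin term at `s` is the Mellin term at `re s`. -/
theorem norm_mellinTerm (s : ℂ) (x : K) (p : ℝ × (Fin (rank K) → ℝ)) :
    ((‖mellinTerm s x p‖ : ℝ) : ℂ) = mellinTerm s.re x p := by
  rw [mellinTerm, mellinTerm, norm_mul, Complex.norm_exp, Complex.norm_real, Real.norm_eq_abs,
    Real.abs_exp, Complex.ofReal_mul]
  congr 1
  rw [Complex.ofReal_exp]
  congr 1
  have h : (Module.finrank ℚ K * s / 2 * p.1 : ℂ) =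
      ((Module.finrank ℚ K / 2 * p.1 : ℝ) : ℂ) * s := by push_cast; ring
  rw [h, Complex.re_ofReal_mul]
  push_cast
  ring

theorem mellinTerm_mul_fundUnit (s : ℂ) (x : K) (k : Fin (rank K) → ℤ)
    (p : ℝ × (Fin (rank K) → ℝ)) :
    mellinTerm s (x * (fundUnit k : K)) p = mellinTerm s x (p.1, fun i => p.2 i + k i) := by
  rw [mellinTerm, mellinTerm, embForm_scaledWeight_add_int]

theorem mellinTerm_mul_torsion (s : ℂ) (x : K) (ζ : torsion K) :
    mellinTerm s (x * ((ζ : (𝓞 K)ˣ) : K)) = mellinTerm s x := by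
  funext p
  rw [mellinTerm, mellinTerm]
  congr 4
  refine Finset.sum_congr rfl fun σ _ => ?_
  have h : ‖σ ((ζ : (𝓞 K)ˣ) : K)‖ = 1 :=
    (mem_torsion K).mp ζ.2 (InfinitePlace.mk σ)
  rw [map_mul, norm_mul, h, mul_one]

/-- Roots of unity do not change the Mellin term, and a unit `∏ ε_i^(k_i)` translates it by `k`. -/
theorem mellinTerm_elementOf (s : ℂ) (I : (FractionalIdeal (𝓞 K)⁰ K)ˣ)
    (q : (IdealsInClass (ClassGroup.mk K I)⁻¹ × torsion K) × (Fin (rank K) → ℤ))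
    (p : ℝ × (Fin (rank K) → ℝ)) :
    mellinTerm s (elementOf I q) p =
      mellinTerm s (idealGen I q.1.1) (p.1, fun i => p.2 i + q.2 i) := by
  rw [elementOf, mellinTerm_mul_fundUnit, mellinTerm_mul_torsion]

/-- Unfolding: the integrals over the unit strip of the translates of an integrable function add up
to its full integral. -/
theorem hasSum_integral_unitStrip {E : Type*} [NormedAddCommGroup E] [NormedSpace ℝ E]
    {f : ℝ × (Fin (rank K) → ℝ) → E} (hf : Integrable f) :
    HasSum (fun k : Fin (rank K) → ℤ => ∫ p in unitStrip K, f (p.1, fun i => p.2 i + k i))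
      (∫ p, f p) := by
  have h := hasSum_integral_unitCube (μ := (volume : Measure (ℝ × (Fin (rank K) → ℝ))))
    (p := Prod.snd) measurable_snd
    (fun k : Fin (rank K) → ℤ => MeasurableEquiv.addRight ((0 : ℝ), fun i => (k i : ℝ)))
    (fun k => by
      have : (volume : Measure (ℝ × (Fin (rank K) → ℝ))).IsAddHaarMeasure :=
        inferInstanceAs ((volume : Measure ℝ).prod
          (volume : Measure (Fin (rank K) → ℝ))).IsAddHaarMeasure
      exact measurePreserving_add_right _ _) (fun k a i => rfl) hf
  have h2 : ∀ (k : Fin (rank K) → ℤ) (p : ℝ × (Fin (rank K) → ℝ)),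
      MeasurableEquiv.addRight ((0 : ℝ), fun i => (k i : ℝ)) p = (p.1, fun i => p.2 i + k i) :=
    fun k p => Prod.ext (add_zero _) rfl
  simp_rw [h2] at h
  exact h

theorem integral_norm_mellinTerm_idealGen (I : (FractionalIdeal (𝓞 K)⁰ K)ˣ) {s : ℂ}
    (hs : 0 < s.re) (J : IdealsInClass (ClassGroup.mk K I)⁻¹) :
    ∫ p, ‖mellinTerm s (idealGen I J) p‖ = ‖(placeFactor K * gammaFactor K s.re : ℂ)‖ *
      (absNorm (I : FractionalIdeal (𝓞 K)⁰ K) : ℝ) ^ (-s.re) *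
        (Ideal.absNorm (J : Ideal (𝓞 K)) : ℝ) ^ (-s.re) := by
  have h1 := integral_mellinTerm (s := (s.re : ℂ)) hs (idealGen_ne_zero I J)
  simp_rw [← norm_mellinTerm, integral_complex_ofReal] at h1
  have h2 := congrArg norm h1
  have hI : 0 < absNorm (I : FractionalIdeal (𝓞 K)⁰ K) :=
    lt_of_le_of_ne (absNorm_nonneg _) (Ne.symm (absNorm_eq_zero_iff.not.mpr I.ne_zero))
  have hJ : (0 : ℚ) < Ideal.absNorm (J : Ideal (𝓞 K)) :=
    Nat.cast_pos.mpr (Nat.pos_of_ne_zero (Ideal.absNorm_ne_zero_of_nonZeroDivisors J.1))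
  rw [Complex.norm_real, Real.norm_of_nonneg (integral_nonneg fun _ => norm_nonneg _),
    abs_norm_idealGen, norm_mul, ← Complex.ofReal_ratCast,
    Complex.norm_cpow_eq_rpow_re_of_pos (by exact_mod_cast mul_pos hJ hI), Complex.neg_re,
    Complex.ofReal_re, Rat.cast_mul, Rat.cast_natCast, Real.mul_rpow (Nat.cast_nonneg _)
    (by exact_mod_cast hI.le)] at h2
  rw [h2]
  ring

theorem summable_idealsInClass (C : ClassGroup (𝓞 K)) {σ : ℝ} (hσ : 1 < σ) :
    Summable fun J : IdealsInClass C => (Ideal.absNorm (J : Ideal (𝓞 K)) : ℝ) ^ (-σ) :=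
  (summable_absNorm_rpow K hσ).comp_injective (i := fun J : IdealsInClass C => (J : Ideal (𝓞 K)))
    fun _ _ h => Subtype.ext (Subtype.ext h)

/-- The Mellin terms of the nonzero elements of `I` are absolutely summable over the unit strip. The sum
over the free part of the units unfolds the strip, the roots of unity contribute their number, and
the sum over the integral ideals in the class remains. -/
theorem mellinTerm_elementOf_unfold (I : (FractionalIdeal (𝓞 K)⁰ K)ˣ) {s : ℂ} (hs : 1 < s.re) :
    (Summable fun q => ∫ p in unitStrip K, ‖mellinTerm s (elementOf I q) p‖) ∧
    HasSum (fun q => ∫ p in unitStrip K, mellinTerm s (elementOf I q) p)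
      (placeFactor K * torsionOrder K * gammaFactor K s *
        ∑' J : IdealsInClass (ClassGroup.mk K I)⁻¹,
          ((Ideal.absNorm (J : Ideal (𝓞 K)) * absNorm (I : FractionalIdeal (𝓞 K)⁰ K) : ℚ) : ℂ)
            ^ (-s)) := by
  have hs0 : 0 < s.re := by linarith
  have hint : ∀ J, Integrable (mellinTerm s (idealGen I J)) := fun J =>
    integrable_mellinTerm hs0 (idealGen_ne_zero I J)
  have hunfold : ∀ r : IdealsInClass (ClassGroup.mk K I)⁻¹ × torsion K,
      HasSum (fun k => ∫ p in unitStrip K, ‖mellinTerm s (elementOf I (r, k)) p‖)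
        (∫ p, ‖mellinTerm s (idealGen I r.1) p‖) := fun r => by
    simp_rw [mellinTerm_elementOf]
    exact hasSum_integral_unitStrip (hint r.1).norm
  have hsum1 : Summable fun J => ∫ p, ‖mellinTerm s (idealGen I J) p‖ := by
    simp_rw [integral_norm_mellinTerm_idealGen I hs0]
    exact (summable_idealsInClass _ hs).mul_left _
  have hsumJ : Summable fun r : IdealsInClass (ClassGroup.mk K I)⁻¹ × torsion K =>
      ∫ p, ‖mellinTerm s (idealGen I r.1) p‖ :=
    (summable_prod_of_nonneg fun r => integral_nonneg fun _ => norm_nonneg _).mpr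
      ⟨fun J => Summable.of_finite, by
        simp only [tsum_const]
        exact hsum1.const_smul _⟩
  have hsumN : Summable fun q => ∫ p in unitStrip K, ‖mellinTerm s (elementOf I q) p‖ :=
    (summable_prod_of_nonneg fun r => integral_nonneg fun _ => norm_nonneg _).mpr
      ⟨fun r => (hunfold r).summable, by simpa only [(hunfold _).tsum_eq] using hsumJ⟩
  refine ⟨hsumN, ?_⟩
  have hsumC : Summable fun q => ∫ p in unitStrip K, mellinTerm s (elementOf I q) p :=
    hsumN.of_norm_bounded fun q => norm_integral_le_integral_norm _
  have hunfold2 : ∀ r : IdealsInClass (ClassGroup.mk K I)⁻¹ × torsion K,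
      HasSum (fun k => ∫ p in unitStrip K, mellinTerm s (elementOf I (r, k)) p)
        (∫ p, mellinTerm s (idealGen I r.1) p) := fun r => by
    simp_rw [mellinTerm_elementOf]
    exact hasSum_integral_unitStrip (hint r.1)
  have h1 : HasSum _ _ := hsumC.hasSum.prod_fiberwise hunfold2
  have h2 : HasSum (fun J => ∑' _ : torsion K, ∫ p, mellinTerm s (idealGen I J) p) _ :=
    h1.prod_fiberwise fun J => (Summable.of_finite).hasSum
  have h3 := h2.tsum_eq
  rw [hsumC.hasSum_iff, ← h3, ← tsum_mul_left]
  refine tsum_congr fun J => ?_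
  rw [tsum_const, integral_mellinTerm hs0 (idealGen_ne_zero I J), abs_norm_idealGen, nsmul_eq_mul,
    ← torsionOrder]
  ring

theorem tsum_mellinTerm (I : (FractionalIdeal (𝓞 K)⁰ K)ˣ) (s : ℂ)
    (p : ℝ × (Fin (rank K) → ℝ)) :
    ∑' q, mellinTerm s (elementOf I q) p = Complex.exp (Module.finrank ℚ K * s / 2 * p.1) *
      (theta (nonzeroElements I) (scaledWeight (Real.exp p.1) p.2) : ℝ) := by
  rw [theta, Complex.ofReal_tsum, ← tsum_mul_left]
  exact (elementEquiv I).tsum_eq fun x : nonzeroElements I => mellinTerm s (x : K) p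

theorem continuous_tsum_mellinTerm (I : (FractionalIdeal (𝓞 K)⁰ K)ˣ) (s : ℂ) :
    Continuous fun p : ℝ × (Fin (rank K) → ℝ) => ∑' q, mellinTerm s (elementOf I q) p := by
  have h : ∀ p : ℝ × (Fin (rank K) → ℝ),
      theta (nonzeroElements I) (scaledWeight (Real.exp p.1) p.2) =
        theta ((I : FractionalIdeal (𝓞 K)⁰ K) : Set K) (scaledWeight (Real.exp p.1) p.2) - 1 :=
    fun p => by rw [theta_scaledWeight_eq_one_add I (Real.exp_pos _)]; ring
  simp_rw [tsum_mellinTerm, h]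
  exact (by fun_prop : Continuous fun p : ℝ × (Fin (rank K) → ℝ) =>
    Complex.exp (Module.finrank ℚ K * s / 2 * p.1)).mul
    (Complex.continuous_ofReal.comp ((continuous_theta_exp I).sub continuous_const))

/-- In the half-plane of convergence, the completed partial zeta function of `I` is a Gamma factor
times the sum over the integral ideals in the inverse class of `I`. -/
theorem completedZeta_eq_tsum (I : (FractionalIdeal (𝓞 K)⁰ K)ˣ) {s : ℂ} (hs : 1 < s.re) :
    completedZeta I s = placeFactor K * torsionOrder K * gammaFactor K s *
        ∑' J : IdealsInClass (ClassGroup.mk K I)⁻¹,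
          ((Ideal.absNorm (J : Ideal (𝓞 K)) * absNorm (I : FractionalIdeal (𝓞 K)⁰ K) : ℚ) : ℂ)
            ^ (-s) := by
  obtain ⟨hsumN, hsumC⟩ := mellinTerm_elementOf_unfold I hs
  have hcount : Countable ((IdealsInClass (ClassGroup.mk K I)⁻¹ × torsion K) ×
    (Fin (rank K) → ℤ)) := by
    have : Countable K := (Module.finBasis ℚ K).equivFun.toEquiv.countable_iff.mpr inferInstance
    exact (elementEquiv I).countable_iff.mpr inferInstance
  have hint : ∀ q, Integrable (mellinTerm s (elementOf I q)) (volume.restrict (unitStrip K)) :=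
    fun q => (integrable_mellinTerm (by linarith)
      (mem_nonzeroElements.mp (elementOf_mem I q)).2).restrict
  have h1 := (hasSum_integral_of_summable_integral_norm hint hsumN).unique hsumC
  have h2 := integrable_tsum_of_summable_integral_norm hint hsumN
    (continuous_tsum_mellinTerm I s).aestronglyMeasurable
  have hstrip : unitStrip K =
      Set.univ ×ˢ (Set.univ.pi fun _ => Set.Ioc (0 : ℝ) (0 + 1)) := by
    ext p
    simp [unitStrip]
  rw [← h1, completedZeta_eq_mellin I hs, mellin_eq_integral_exp]
  rw [hstrip] at h2 ⊢
  rw [show (volume : Measure (ℝ × (Fin (rank K) → ℝ))) = volume.prod volume from rfl,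
    setIntegral_prod _ h2, setIntegral_univ]
  refine integral_congr_ae (ae_of_all _ fun v => ?_)
  have hae : (Set.univ.pi fun _ : Fin (rank K) => Set.Ioc (0 : ℝ) (0 + 1)) =ᵐ[volume]
      Set.Icc (0 : Fin (rank K) → ℝ) 1 := by
    have := Measure.univ_pi_Ioc_ae_eq_Icc (μ := fun _ : Fin (rank K) => (volume : Measure ℝ))
      (f := 0) (g := 1)
    rw [← volume_pi] at this
    simpa using this
  dsimp only
  rw [setIntegral_congr_set hae, unitTheta_sub_one I (Real.exp_pos v), ← integral_complex_ofReal,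
    smul_eq_mul, ← integral_const_mul]
  exact integral_congr_ae (ae_of_all _ fun c => (tsum_mellinTerm I s (v, c)).symm)

end Unfolding

end DedekindNorthcott

namespace DedekindNorthcott

open MeasureTheory Real NumberField
open scoped nonZeroDivisors

/-! ### Gamma factors -/

section GammaFactors

/-- The Gamma factor of a place of local degree `m`. -/
noncomputable def placeGamma (m : ℕ) (s : ℂ) : ℂ :=
  ((π * m : ℝ) : ℂ) ^ (-(m * s / 2)) * Complex.Gamma (m * s / 2)

/-- The Gamma factor of a number field with `a` real and `b` complex places. -/
noncomputable def gammaProd (a b : ℕ) (s : ℂ) : ℂ := placeGamma 1 s ^ a * placeGamma 2 s ^ b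

theorem placeGamma_ne_zero {m : ℕ} (hm : 0 < m) {s : ℂ} (hs : 0 < s.re) : placeGamma m s ≠ 0 := by
  have hm' : (0 : ℝ) < m := Nat.cast_pos.mpr hm
  refine mul_ne_zero ?_ (Complex.Gamma_ne_zero_of_re_pos ?_)
  · rw [Complex.cpow_ne_zero_iff]
    exact Or.inl (Complex.ofReal_ne_zero.mpr (mul_pos pi_pos hm').ne')
  · rw [show (m * s / 2 : ℂ) = ((m / 2 : ℝ) : ℂ) * s by push_cast; ring, Complex.re_ofReal_mul]
    exact mul_pos (half_pos hm') hs

theorem meromorphic_placeGamma {m : ℕ} (hm : 0 < m) : Meromorphic (placeGamma m) := by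
  have hpi : ((π * m : ℝ) : ℂ) ≠ 0 :=
    Complex.ofReal_ne_zero.mpr (mul_pos pi_pos (Nat.cast_pos.mpr hm)).ne'
  intro z
  refine MeromorphicAt.mul ?_ ?_
  · have h : Differentiable ℂ fun s : ℂ => ((π * m : ℝ) : ℂ) ^ (-(m * s / 2)) := fun s =>
      DifferentiableAt.const_cpow (by fun_prop) (Or.inl hpi)
    exact (h.analyticAt z).meromorphicAt
  · have h : Differentiable ℂ fun s : ℂ => (Complex.Gamma (m * s / 2))⁻¹ :=
      Complex.differentiable_one_div_Gamma.comp (g := fun s => (Complex.Gamma s)⁻¹)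
        (f := fun s : ℂ => m * s / 2) (by fun_prop)
    have h2 := (h.analyticAt z).meromorphicAt.inv
    refine h2.congr (Filter.Eventually.of_forall fun s => ?_)
    simp

theorem gammaProd_ne_zero (a b : ℕ) {s : ℂ} (hs : 0 < s.re) : gammaProd a b s ≠ 0 :=
  mul_ne_zero (pow_ne_zero _ (placeGamma_ne_zero one_pos hs))
    (pow_ne_zero _ (placeGamma_ne_zero two_pos hs))

theorem meromorphic_gammaProd (a b : ℕ) : Meromorphic (gammaProd a b) := fun z =>
  ((meromorphic_placeGamma one_pos z).pow a).mul ((meromorphic_placeGamma two_pos z).pow b)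

open InfinitePlace in
theorem gammaFactor_eq_gammaProd (K : Type*) [Field K] [NumberField K] (s : ℂ) :
    gammaFactor K s = gammaProd (nrRealPlaces K) (nrComplexPlaces K) s := by
  classical
  have h : ∀ w : InfinitePlace K, ((π * mult w : ℝ) : ℂ) ^ (-(mult w * s / 2)) *
      Complex.Gamma (mult w * s / 2) = if IsReal w then placeGamma 1 s else placeGamma 2 s := by
    intro w
    change placeGamma (mult w) s = _
    split_ifs with hw
    · rw [hw.mult_eq_one]
    · rw [(not_isReal_iff_isComplex.mp hw).mult_eq_two]
  rw [gammaFactor, Finset.prod_congr rfl fun w _ => h w, Finset.prod_ite, Finset.prod_const,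
    Finset.prod_const, gammaProd, nrRealPlaces, nrComplexPlaces, Fintype.card_subtype,
    Fintype.card_subtype]
  simp only [not_isReal_iff_isComplex]

/-- The quotient of Gamma factors in the functional equation. -/
noncomputable def gammaRatio (a b : ℕ) (s : ℂ) : ℂ := gammaProd a b (1 - s) * (gammaProd a b s)⁻¹

theorem meromorphic_gammaProd_one_sub (a b : ℕ) :
    Meromorphic fun s => gammaProd a b (1 - s) := fun z =>
  (meromorphic_gammaProd a b (1 - z)).comp_analyticAt (g := fun s : ℂ => 1 - s)
    (by fun_prop)

theorem meromorphic_gammaRatio (a b : ℕ) : Meromorphic (gammaRatio a b) := fun z =>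
  (meromorphic_gammaProd_one_sub a b z).mul (meromorphic_gammaProd a b z).inv

theorem meromorphicTrailingCoeffAt_gammaRatio_ne_zero (a b : ℕ) (s : ℂ) :
    meromorphicTrailingCoeffAt (gammaRatio a b) s ≠ 0 := by
  refine (meromorphic_gammaRatio a b s).meromorphicTrailingCoeffAt_ne_zero ?_
  refine MeromorphicOn.meromorphicOrderAt_ne_top_of_isPreconnected
    (meromorphicOn_univ.mpr (meromorphic_gammaRatio a b)) isPreconnected_univ
    (Set.mem_univ (1 / 2)) (Set.mem_univ s) ?_
  -- on the strip `0 < re z < 1` neither Gamma factor vanishes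
  rw [Ne, meromorphicOrderAt_eq_top_iff]
  intro h
  have hU : {z : ℂ | 0 < z.re ∧ z.re < 1} ∈ nhds (1 / 2 : ℂ) :=
    ((isOpen_lt continuous_const Complex.continuous_re).inter
      (isOpen_lt Complex.continuous_re continuous_const)).mem_nhds (by norm_num)
  obtain ⟨z, hz, hz1, hz2⟩ := (h.and (mem_nhdsWithin_of_mem_nhds hU)).exists
  exact mul_ne_zero (gammaProd_ne_zero a b (by rw [Complex.sub_re, Complex.one_re]; linarith))
    (inv_ne_zero (gammaProd_ne_zero a b hz1)) hz

end GammaFactors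

/-! ### The functional equation -/

section FunctionalEquation

variable (K : Type*) [Field K] [NumberField K]

open NumberField.Units FractionalIdeal

variable {K} in
/-- The completed partial zeta function, normalized so that it depends only on the class of `I`. -/
noncomputable def normalizedZeta (I : (FractionalIdeal (𝓞 K)⁰ K)ˣ) (s : ℂ) : ℂ :=
  (latticeVol I : ℂ) ^ s * completedZeta I s

/-- The factor completing the Dedekind zeta function of `K`. -/
noncomputable def completingFactor (s : ℂ) : ℂ :=
  placeFactor K * torsionOrder K * gammaFactor K s * ((√|(discr K : ℝ)| : ℝ) : ℂ) ^ s

theorem sqrt_abs_discr_pos : 0 < √|(discr K : ℝ)| :=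
  Real.sqrt_pos.mpr (abs_pos.mpr (Int.cast_ne_zero.mpr (discr_ne_zero K)))

variable {K} in
theorem cpow_latticeVol_mul (I : (FractionalIdeal (𝓞 K)⁰ K)ˣ) (s : ℂ) (m : ℕ) :
    (latticeVol I : ℂ) ^ s * ((m * absNorm (I : FractionalIdeal (𝓞 K)⁰ K) : ℚ) : ℂ) ^ (-s) =
      ((√|(discr K : ℝ)| : ℝ) : ℂ) ^ s * (m : ℂ) ^ (-s) := by
  have hI : (0 : ℝ) < (absNorm (I : FractionalIdeal (𝓞 K)⁰ K) : ℝ) := by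
    have h := latticeVol_pos I
    exact pos_of_mul_pos_right h (Real.sqrt_nonneg _)
  have h1 : ((m * absNorm (I : FractionalIdeal (𝓞 K)⁰ K) : ℚ) : ℂ) =
      ((m : ℝ) : ℂ) * ((absNorm (I : FractionalIdeal (𝓞 K)⁰ K) : ℝ) : ℂ) := by
    push_cast; ring
  rw [h1, Complex.mul_cpow_ofReal_nonneg (Nat.cast_nonneg _) hI.le, latticeVol, Complex.ofReal_mul,
    Complex.mul_cpow_ofReal_nonneg (Real.sqrt_nonneg _) hI.le,
    Complex.cpow_neg ((absNorm (I : FractionalIdeal (𝓞 K)⁰ K) : ℝ) : ℂ)]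
  have h2 : ((absNorm (I : FractionalIdeal (𝓞 K)⁰ K) : ℝ) : ℂ) ^ s ≠ 0 := by
    rw [Complex.cpow_ne_zero_iff]
    exact Or.inl (Complex.ofReal_ne_zero.mpr hI.ne')
  rw [Complex.ofReal_natCast]
  field_simp

variable {K} in
theorem normalizedZeta_eq_tsum {I : (FractionalIdeal (𝓞 K)⁰ K)ˣ} {C : ClassGroup (𝓞 K)}
    (hC : (ClassGroup.mk K I)⁻¹ = C) {s : ℂ} (hs : 1 < s.re) :
    normalizedZeta I s = completingFactor K s *
      ∑' J : IdealsInClass C, (Ideal.absNorm (J : Ideal (𝓞 K)) : ℂ) ^ (-s) := by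
  subst hC
  rw [normalizedZeta, completedZeta_eq_tsum I hs, mul_left_comm, ← tsum_mul_left]
  simp_rw [cpow_latticeVol_mul]
  rw [tsum_mul_left, completingFactor]
  ring

variable {K} in
/-- The powers of the covolume in the functional equation are absorbed by the normalization, as dual
ideals have inverse covolumes. -/
theorem normalizedZeta_one_sub (I : (FractionalIdeal (𝓞 K)⁰ K)ˣ) {s : ℂ} (hs : 1 < s.re) :
    normalizedZeta I (1 - s) = normalizedZeta (dualIdeal I) s := by
  have hpos := latticeVol_pos I
  have h0 : (latticeVol I : ℂ) ≠ 0 := Complex.ofReal_ne_zero.mpr hpos.ne'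
  rw [normalizedZeta, normalizedZeta, completedZeta_one_sub I hs,
    completedZeta_eq_mellin (dualIdeal I) hs, latticeVol_dualIdeal, Complex.ofReal_inv,
    Complex.inv_cpow_eq_ite, if_neg, Complex.cpow_sub _ _ h0, Complex.cpow_one]
  · field_simp
  · rw [Complex.arg_ofReal_of_nonneg hpos.le]
    exact pi_pos.ne

/-- Partition of the Dedekind series by ideal classes. -/
theorem tsum_classGroup {s : ℂ} (hs : 1 < s.re) :
    ∑ C : ClassGroup (𝓞 K), ∑' J : IdealsInClass C, (Ideal.absNorm (J : Ideal (𝓞 K)) : ℂ) ^ (-s) =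
      dedekindZeta K s := by
  have hs0 : -s ≠ 0 := by
    intro h
    rw [neg_eq_zero] at h
    rw [h, Complex.zero_re] at hs
    linarith
  have h1 : dedekindZeta K s =
      ∑' J : (Ideal (𝓞 K))⁰, (Ideal.absNorm (J : Ideal (𝓞 K)) : ℂ) ^ (-s) := by
    rw [dedekindZeta_eq_tsum K hs]
    refine (tsum_subtype_eq_of_support_subset (s := ((Ideal (𝓞 K))⁰ : Set (Ideal (𝓞 K))))
      fun J hJ => ?_).symm
    refine mem_nonZeroDivisors_iff_ne_zero.mpr ?_
    rintro rfl
    simp [Complex.zero_cpow hs0] at hJ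
  have h2 : Summable fun J : (Ideal (𝓞 K))⁰ => (Ideal.absNorm (J : Ideal (𝓞 K)) : ℂ) ^ (-s) :=
    (summable_absNorm_cpow K hs).comp_injective Subtype.val_injective
  rw [h1, ← (Equiv.sigmaFiberEquiv fun J : (Ideal (𝓞 K))⁰ => ClassGroup.mk0 J).tsum_eq]
  rw [← (Equiv.sigmaFiberEquiv fun J : (Ideal (𝓞 K))⁰ => ClassGroup.mk0 J).summable_iff] at h2
  rw [← tsum_fintype (L := SummationFilter.unconditional _)]
  exact h2.tsum_sigma.symm

variable {K} in
/-- A fractional ideal in the given ideal class. -/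
noncomputable def classRep (C : ClassGroup (𝓞 K)) : (FractionalIdeal (𝓞 K)⁰ K)ˣ :=
  FractionalIdeal.mk0 K (ClassGroup.mk0_surjective C).choose

variable {K} in
theorem mk_classRep (C : ClassGroup (𝓞 K)) : ClassGroup.mk K (classRep C) = C := by
  rw [classRep, ClassGroup.mk_mk0, (ClassGroup.mk0_surjective C).choose_spec]

variable {K} in
theorem mk_dualIdeal (I : (FractionalIdeal (𝓞 K)⁰ K)ˣ) :
    ClassGroup.mk K (dualIdeal I) = ClassGroup.mk K (dualIdeal 1) * (ClassGroup.mk K I)⁻¹ := by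
  rw [← map_inv, ← map_mul]
  refine congrArg (ClassGroup.mk K) (Units.ext ?_)
  rw [Units.val_mul, Units.val_inv_eq_inv_val]
  exact dual_eq_mul_inv ℤ ℚ (I := (I : FractionalIdeal (𝓞 K)⁰ K))

/-- The Dedekind zeta function times its completing factor, as a sum over the ideal classes of
continued Mellin transforms. -/
noncomputable def totalZeta (s : ℂ) : ℂ :=
  ∑ C : ClassGroup (𝓞 K), normalizedZeta (classRep C) s

theorem totalZeta_eq {s : ℂ} (hs : 1 < s.re) :
    totalZeta K s = completingFactor K s * dedekindZeta K s := by
  rw [totalZeta, ← tsum_classGroup K hs, ← Equiv.sum_comp (Equiv.inv (ClassGroup (𝓞 K))), Finset.mul_sum]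
  refine Finset.sum_congr rfl fun C _ => ?_
  exact normalizedZeta_eq_tsum (by rw [mk_classRep, Equiv.inv_apply, inv_inv]) hs

/-- The trace dual acts on the class group by `C ↦ D C⁻¹` with `D` the class of the dual of `1`, so the
functional equations of the partial zeta functions add up to one of the full sum. -/
theorem totalZeta_one_sub {s : ℂ} (hs : 1 < s.re) :
    totalZeta K (1 - s) = completingFactor K s * dedekindZeta K s := by
  rw [totalZeta, ← tsum_classGroup K hs,
    ← Equiv.sum_comp (Equiv.mulLeft (ClassGroup.mk K (dualIdeal (1 : (FractionalIdeal (𝓞 K)⁰ K)ˣ)))),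
    Finset.mul_sum]
  refine Finset.sum_congr rfl fun C _ => ?_
  rw [normalizedZeta_one_sub _ hs]
  refine normalizedZeta_eq_tsum ?_ hs
  rw [mk_dualIdeal, mk_classRep, mul_inv, inv_inv]
  exact inv_mul_cancel_left _ C

theorem meromorphic_totalZeta : Meromorphic (totalZeta K) := fun z => by
  refine MeromorphicAt.fun_sum fun C _ => ?_
  refine MeromorphicAt.mul ?_ (meromorphic_completedZeta _ z)
  have h : Differentiable ℂ fun s : ℂ => (latticeVol (classRep C) : ℂ) ^ s := fun s =>
    DifferentiableAt.const_cpow (by fun_prop)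
      (Or.inl (Complex.ofReal_ne_zero.mpr (latticeVol_pos _).ne'))
  exact (h.analyticAt z).meromorphicAt

theorem analyticAt_sqrt_discr_cpow {g : ℂ → ℂ} (hg : Differentiable ℂ g) (z : ℂ) :
    AnalyticAt ℂ (fun s => ((√|(discr K : ℝ)| : ℝ) : ℂ) ^ g s) z := by
  have h : Differentiable ℂ fun s : ℂ => ((√|(discr K : ℝ)| : ℝ) : ℂ) ^ g s := fun s =>
    DifferentiableAt.const_cpow (hg s)
      (Or.inl (Complex.ofReal_ne_zero.mpr (sqrt_abs_discr_pos K).ne'))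
  exact h.analyticAt z

theorem sqrt_discr_cpow_ne_zero (s : ℂ) : ((√|(discr K : ℝ)| : ℝ) : ℂ) ^ s ≠ 0 := by
  rw [Complex.cpow_ne_zero_iff]
  exact Or.inl (Complex.ofReal_ne_zero.mpr (sqrt_abs_discr_pos K).ne')

theorem placeFactor_mul_torsionOrder_ne_zero : (placeFactor K * torsionOrder K : ℂ) ≠ 0 := by
  refine mul_ne_zero ?_ (Nat.cast_ne_zero.mpr (torsionOrder_pos K).ne')
  have : (placeFactor K : ℝ) ≠ 0 := by exact_mod_cast (placeFactor_pos (K := K)).ne'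
  exact_mod_cast this

theorem completingFactor_ne_zero {s : ℂ} (hs : 0 < s.re) : completingFactor K s ≠ 0 := by
  refine mul_ne_zero (mul_ne_zero (placeFactor_mul_torsionOrder_ne_zero K) ?_)
    (sqrt_discr_cpow_ne_zero K s)
  rw [gammaFactor_eq_gammaProd]
  exact gammaProd_ne_zero _ _ hs

theorem meromorphic_completingFactor : Meromorphic (completingFactor K) := fun z => by
  refine MeromorphicAt.mul (MeromorphicAt.mul (MeromorphicAt.const _ z) ?_)
    (analyticAt_sqrt_discr_cpow K differentiable_id z).meromorphicAt
  rw [funext (gammaFactor_eq_gammaProd K)]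
  exact meromorphic_gammaProd _ _ z

/-- The meromorphic continuation of the Dedekind zeta function. -/
noncomputable def continuedZeta (s : ℂ) : ℂ := totalZeta K s * (completingFactor K s)⁻¹

theorem meromorphic_continuedZeta : Meromorphic (continuedZeta K) := fun z =>
  (meromorphic_totalZeta K z).mul (meromorphic_completingFactor K z).inv

theorem continuedZeta_eq {s : ℂ} (hs : 1 < s.re) : continuedZeta K s = dedekindZeta K s := by
  have h := completingFactor_ne_zero K (s := s) (by linarith)
  rw [continuedZeta, totalZeta_eq K hs]
  field_simp

open InfinitePlace in
/-- The functional equation of the Dedekind zeta function. -/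
theorem continuedZeta_functional_equation {s : ℂ} (hs : s.re < 0) :
    continuedZeta K s = ((√|(discr K : ℝ)| : ℝ) : ℂ) ^ (1 - 2 * s) *
      gammaRatio (nrRealPlaces K) (nrComplexPlaces K) s * dedekindZeta K (1 - s) := by
  have h1 := totalZeta_one_sub K (s := 1 - s) (by rw [Complex.sub_re, Complex.one_re]; linarith)
  rw [sub_sub_cancel] at h1
  have h2 := left_ne_zero_of_mul (placeFactor_mul_torsionOrder_ne_zero K)
  have h4 := right_ne_zero_of_mul (placeFactor_mul_torsionOrder_ne_zero K)
  have h3 := sqrt_discr_cpow_ne_zero K s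
  rw [continuedZeta, h1, completingFactor, completingFactor, gammaFactor_eq_gammaProd,
    gammaFactor_eq_gammaProd, gammaRatio, show 1 - 2 * s = (1 - s) - s by ring,
    Complex.cpow_sub (1 - s) s (Complex.ofReal_ne_zero.mpr (sqrt_abs_discr_pos K).ne')]
  rw [mul_inv, mul_inv]
  field_simp

/-- The identity theorem: meromorphic functions that agree for `1 < re z` agree near every point,
except possibly at the point itself. -/
theorem eventuallyEq_of_meromorphic_of_eq_half_plane {f g : ℂ → ℂ} (hf : Meromorphic f)
    (hg : Meromorphic g) (hfg : ∀ z : ℂ, 1 < z.re → f z = g z) (s : ℂ) :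
    f =ᶠ[nhdsWithin s {s}ᶜ] g := by
  have hd : Meromorphic (f - g) := fun z => (hf z).sub (hg z)
  have h2 : meromorphicOrderAt (f - g) 2 = ⊤ := by
    rw [meromorphicOrderAt_eq_top_iff]
    refine Filter.Eventually.filter_mono nhdsWithin_le_nhds ?_
    filter_upwards [(isOpen_lt continuous_const Complex.continuous_re).mem_nhds
      (show (1 : ℝ) < (2 : ℂ).re by norm_num)] with z hz
    exact sub_eq_zero.mpr (hfg z hz)
  have h3 : meromorphicOrderAt (f - g) s = ⊤ := by
    by_contra h
    exact MeromorphicOn.meromorphicOrderAt_ne_top_of_isPreconnected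
      (meromorphicOn_univ.mpr hd) isPreconnected_univ (Set.mem_univ s) (Set.mem_univ 2) h h2
  filter_upwards [meromorphicOrderAt_eq_top_iff.mp h3] with z hz
  exact sub_eq_zero.mp hz

theorem analyticAt_dedekindZeta {s : ℂ} (hs : 1 < s.re) : AnalyticAt ℂ (dedekindZeta K) s := by
  refine LSeries_analyticOnNhd _ s ?_
  refine lt_of_le_of_lt (LSeries.abscissaOfAbsConv_le_of_forall_lt_LSeriesSummable (x := 1)
    fun y hy => ?_) (by exact_mod_cast hs)
  have := lseriesSummable_card_absNorm K (s := (y : ℂ)) (by simpa using hy)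
  simpa using this

end FunctionalEquation

/-! ### The special value in the left half-plane -/

section SpecialValue

variable (K : Type u) [Field K] [NumberField K]

theorem dedekindZetaMero_eventuallyEq (s : ℂ) :
    dedekindZetaMero K =ᶠ[nhdsWithin s {s}ᶜ] continuedZeta K := by
  have h : ∃ f : ℂ → ℂ, Meromorphic f ∧ ∀ z : ℂ, 1 < z.re → f z = dedekindZeta K z :=
    ⟨continuedZeta K, meromorphic_continuedZeta K, fun z hz => continuedZeta_eq K hz⟩
  rw [dedekindZetaMero, meromorphicContinuation, dif_pos h]
  exact eventuallyEq_of_meromorphic_of_eq_half_plane h.choose_spec.1 (meromorphic_continuedZeta K)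
    (fun z hz => (h.choose_spec.2 z hz).trans (continuedZeta_eq K hz).symm) s

open InfinitePlace in
/-- The absolute value of the special value, read off from the functional equation. -/
theorem norm_dedekindSpecialValue {s : ℂ} (hs : s.re < 0) (h0 : dedekindZeta K (1 - s) ≠ 0) :
    ‖dedekindSpecialValue K s‖ = √|(discr K : ℝ)| ^ (1 - 2 * s.re) *
      ‖meromorphicTrailingCoeffAt (gammaRatio (nrRealPlaces K) (nrComplexPlaces K)) s‖ *
        ‖dedekindZeta K (1 - s)‖ := by
  have hev : dedekindZetaMero K =ᶠ[nhdsWithin s {s}ᶜ] fun z =>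
      ((√|(discr K : ℝ)| : ℝ) : ℂ) ^ (1 - 2 * z) *
      gammaRatio (nrRealPlaces K) (nrComplexPlaces K) z * dedekindZeta K (1 - z) := by
    refine (dedekindZetaMero_eventuallyEq K s).trans ?_
    refine Filter.Eventually.filter_mono nhdsWithin_le_nhds ?_
    filter_upwards [(isOpen_lt Complex.continuous_re continuous_const).mem_nhds hs] with z hz
    exact continuedZeta_functional_equation K hz
  have ha := analyticAt_sqrt_discr_cpow K (g := fun z => 1 - 2 * z) (by fun_prop) s
  have hz : AnalyticAt ℂ (fun z => dedekindZeta K (1 - z)) s :=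
    (analyticAt_dedekindZeta K (s := 1 - s)
      (by rw [Complex.sub_re, Complex.one_re]; linarith)).fun_comp (by fun_prop)
  have hg := meromorphic_gammaRatio (nrRealPlaces K) (nrComplexPlaces K) s
  rw [dedekindSpecialValue, meromorphicTrailingCoeffAt_congr_nhdsNE hev,
    MeromorphicAt.meromorphicTrailingCoeffAt_fun_mul (ha.meromorphicAt.fun_mul hg) hz.meromorphicAt,
    MeromorphicAt.meromorphicTrailingCoeffAt_fun_mul ha.meromorphicAt hg,
    ha.meromorphicTrailingCoeffAt_of_ne_zero (sqrt_discr_cpow_ne_zero K _),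
    hz.meromorphicTrailingCoeffAt_of_ne_zero h0, norm_mul, norm_mul,
    Complex.norm_cpow_eq_rpow_re_of_pos (sqrt_abs_discr_pos K)]
  simp

end SpecialValue

end DedekindNorthcott

namespace DedekindNorthcott

open NumberField

/-! ### A lower bound for the Dedekind zeta function in the half-plane of convergence -/

section LowerBound

variable {K : Type*} [Field K] [NumberField K]

/-- The ideals not divisible by any member of `S`. -/
def idealsAway (S : Finset (Ideal (𝓞 K))) : Set (Ideal (𝓞 K)) := {J | ∀ q ∈ S, ¬ q ∣ J}

/-- The part of the Dedekind series over the ideals not divisible by any member of `S`. -/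
noncomputable def zetaAway (S : Finset (Ideal (𝓞 K))) (w : ℂ) : ℂ :=
  ∑' J : Ideal (𝓞 K), (idealsAway S).indicator (fun J => (Ideal.absNorm J : ℂ) ^ (-w)) J

theorem zetaAway_empty {w : ℂ} (hw : 1 < w.re) : zetaAway (∅ : Finset (Ideal (𝓞 K))) w =
    dedekindZeta K w := by
  rw [dedekindZeta_eq_tsum K hw, zetaAway]
  exact tsum_congr fun J => Set.indicator_of_mem (by simp [idealsAway]) _

open scoped Classical in
theorem idealsAway_insert {S : Finset (Ideal (𝓞 K))} {p : Ideal (𝓞 K)} (hp : Prime p)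
    (hS : ∀ q ∈ S, Prime q) (hpS : p ∉ S) :
    idealsAway S = idealsAway (insert p S) ∪ (fun J => p * J) '' idealsAway S := by
  ext J
  constructor
  · intro hJ
    by_cases hpJ : p ∣ J
    · obtain ⟨J', rfl⟩ := hpJ
      exact Or.inr ⟨J', fun q hq h => hJ q hq (h.mul_left p), rfl⟩
    · refine Or.inl fun q hq => ?_
      rcases Finset.mem_insert.mp hq with rfl | hq
      · exact hpJ
      · exact hJ q hq
  · rintro (hJ | ⟨J', hJ', rfl⟩) q hq h
    · exact hJ q (Finset.mem_insert_of_mem hq) h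
    · rcases (hS q hq).dvd_or_dvd h with h | h
      · have := associated_iff_eq.mp ((hS q hq).associated_of_dvd hp h)
        exact hpS (this ▸ hq)
      · exact hJ' q hq h

open scoped Classical in
/-- Removing the multiples of a prime `p` multiplies the series by the Euler factor
`1 - N(p)^(-w)`. -/
theorem zetaAway_insert {S : Finset (Ideal (𝓞 K))} {p : Ideal (𝓞 K)} (hp : Prime p)
    (hS : ∀ q ∈ S, Prime q) (hpS : p ∉ S) {w : ℂ} (hw : 1 < w.re) :
    zetaAway (insert p S) w = (1 - (Ideal.absNorm p : ℂ) ^ (-w)) * zetaAway S w := by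
  have hinj : Function.Injective fun J : Ideal (𝓞 K) => p * J := mul_right_injective₀ hp.ne_zero
  have hdisj : Disjoint (idealsAway (insert p S)) ((fun J => p * J) '' idealsAway S) := by
    refine Set.disjoint_left.mpr ?_
    rintro _ hJ ⟨J', -, rfl⟩
    exact hJ p (Finset.mem_insert_self _ _) (dvd_mul_right p J')
  have hsum := summable_absNorm_cpow K hw
  have h1 : zetaAway S w = zetaAway (insert p S) w + ∑' J : Ideal (𝓞 K),
      ((fun J => p * J) '' idealsAway S).indicator (fun J => (Ideal.absNorm J : ℂ) ^ (-w)) J := by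
    rw [zetaAway, zetaAway, ← (hsum.indicator _).tsum_add (hsum.indicator _)]
    refine tsum_congr fun J => ?_
    conv_lhs => rw [idealsAway_insert hp hS hpS]
    rw [Set.indicator_union_of_disjoint hdisj]
  have h2 : ∑' J : Ideal (𝓞 K), ((fun J => p * J) '' idealsAway S).indicator
      (fun J => (Ideal.absNorm J : ℂ) ^ (-w)) J = (Ideal.absNorm p : ℂ) ^ (-w) * zetaAway S w := by
    rw [zetaAway, ← tsum_mul_left, ← hinj.tsum_eq]
    · refine tsum_congr fun J => ?_
      by_cases hJ : J ∈ idealsAway S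
      · rw [Set.indicator_of_mem (Set.mem_image_of_mem _ hJ), Set.indicator_of_mem hJ, map_mul,
          Nat.cast_mul, Complex.natCast_mul_natCast_cpow]
      · rw [Set.indicator_of_notMem (hinj.mem_set_image.not.mpr hJ), Set.indicator_of_notMem hJ,
          mul_zero]
    · exact Set.support_indicator_subset.trans (Set.image_subset_range _ _)
  rw [h2] at h1
  linear_combination -h1

theorem zetaAway_eq_prod {S : Finset (Ideal (𝓞 K))} (hS : ∀ q ∈ S, Prime q) {w : ℂ}
    (hw : 1 < w.re) :
    zetaAway S w = (∏ q ∈ S, (1 - (Ideal.absNorm q : ℂ) ^ (-w))) * dedekindZeta K w := by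
  classical
  induction S using Finset.induction with
  | empty => rw [zetaAway_empty hw, Finset.prod_empty, one_mul]
  | insert p S hpS ih =>
    have hS' : ∀ q ∈ S, Prime q := fun q hq => hS q (Finset.mem_insert_of_mem hq)
    rw [zetaAway_insert (hS p (Finset.mem_insert_self _ _)) hS' hpS hw, ih hS',
      Finset.prod_insert hpS, mul_assoc]

variable (K) in
/-- The nonzero prime ideals of norm at most `N`. -/
noncomputable def primesNormLe (N : ℕ) : Finset (Ideal (𝓞 K)) :=
  ((Ideal.finite_setOfPred_absNorm_le (S := 𝓞 K) N).subset
    (Set.inter_subset_right (s := {q | Prime q}))).toFinset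

theorem mem_primesNormLe {N : ℕ} {q : Ideal (𝓞 K)} :
    q ∈ primesNormLe K N ↔ Prime q ∧ Ideal.absNorm q ≤ N := by
  simp [primesNormLe]

open Filter in
/-- When all primes are removed, only the term of the unit ideal remains. -/
theorem tendsto_zetaAway {w : ℂ} (hw : 1 < w.re) :
    Tendsto (fun N => zetaAway (primesNormLe K N) w) atTop (nhds 1) := by
  have hw0 : -w ≠ 0 := by
    intro h
    rw [neg_eq_zero] at h
    rw [h, Complex.zero_re] at hw
    linarith
  have hlim : ∑' J : Ideal (𝓞 K), (if J = ⊤ then (1 : ℂ) else 0) = 1 := tsum_ite_eq _ _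
  rw [← hlim]
  refine tendsto_tsum_of_dominated_convergence (summable_absNorm_cpow K hw).norm ?_ ?_
  · intro J
    rcases eq_or_ne J ⊤ with rfl | hJ
    · refine tendsto_const_nhds.congr fun N => ?_
      rw [if_pos rfl, Set.indicator_of_mem]
      · simp
      · intro q hq h
        rw [← Ideal.one_eq_top] at h
        exact (mem_primesNormLe.mp hq).1.not_isUnit (isUnit_of_dvd_one h)
    · rw [if_neg hJ]
      rcases eq_or_ne J ⊥ with rfl | hJ0
      · refine tendsto_const_nhds.congr fun N => ?_
        refine (Set.indicator_apply_eq_zero.mpr fun _ => ?_).symm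
        simp [Complex.zero_cpow hw0]
      · obtain ⟨q, hq, hqJ⟩ := WfDvdMonoid.exists_irreducible_factor
          (fun h => hJ (Ideal.isUnit_iff.mp h)) hJ0
        refine tendsto_const_nhds.congr' ?_
        filter_upwards [eventually_ge_atTop (Ideal.absNorm q)] with N hN
        rw [Set.indicator_of_notMem]
        exact fun h => h q (mem_primesNormLe.mpr ⟨hq.prime, hN⟩) hqJ
  · exact Eventually.of_forall fun N J => norm_indicator_le_norm_self _ _

/-- The rational prime below a prime ideal. -/
noncomputable def primeBelow (q : Ideal (𝓞 K)) : ℕ := Ideal.absNorm (Ideal.under ℤ q)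

theorem primeBelow_prime {q : Ideal (𝓞 K)} (hq : Prime q) : (primeBelow q).Prime := by
  have : q.IsPrime := Ideal.isPrime_of_prime hq
  have : NeZero q := ⟨hq.ne_zero⟩
  exact Nat.absNorm_under_prime q

theorem primeBelow_le_absNorm {q : Ideal (𝓞 K)} (hq : Prime q) :
    primeBelow q ≤ Ideal.absNorm q := by
  refine Nat.le_of_dvd (Nat.pos_of_ne_zero ?_) (Int.absNorm_under_dvd_absNorm q)
  exact Ideal.absNorm_eq_zero_iff.not.mpr hq.ne_zero

theorem dvd_span_primeBelow (q : Ideal (𝓞 K)) :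
    q ∣ Ideal.span {((primeBelow q : ℕ) : 𝓞 K)} := by
  rw [Ideal.dvd_span_singleton]
  exact Int.absNorm_under_mem q

/-- At most `[K : ℚ]` prime ideals lie above a rational prime. -/
theorem card_primeBelow_fiber_le {S : Finset (Ideal (𝓞 K))} (hS : ∀ q ∈ S, Prime q) (p : ℕ) :
    (S.filter fun q => primeBelow q = p).card ≤ Module.finrank ℚ K := by
  rcases (S.filter fun q => primeBelow q = p).eq_empty_or_nonempty with h | ⟨q₀, hq₀⟩
  · rw [h]; exact Nat.zero_le _
  have hp : p.Prime := by
    obtain ⟨h1, h2⟩ := Finset.mem_filter.mp hq₀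
    exact h2 ▸ primeBelow_prime (hS q₀ h1)
  have hdvd : ∏ q ∈ S.filter fun q => primeBelow q = p, q ∣ Ideal.span {((p : ℕ) : 𝓞 K)} :=
    Finset.prod_primes_dvd _ (fun q hq => hS q (Finset.mem_filter.mp hq).1)
      fun q hq => (Finset.mem_filter.mp hq).2 ▸ dvd_span_primeBelow q
  have h1 := Ideal.absNorm_dvd_absNorm_of_le (Ideal.dvd_iff_le.mp hdvd)
  rw [Ideal.absNorm_span_natCast, RingOfIntegers.rank, map_prod] at h1
  have h2 : p ^ (S.filter fun q => primeBelow q = p).card ≤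
      ∏ q ∈ S.filter fun q => primeBelow q = p, Ideal.absNorm q := by
    refine Finset.pow_card_le_prod _ _ _ fun q hq => ?_
    obtain ⟨h3, h4⟩ := Finset.mem_filter.mp hq
    exact h4 ▸ primeBelow_le_absNorm (hS q h3)
  exact (Nat.pow_le_pow_iff_right hp.one_lt).mp
    (h2.trans (Nat.le_of_dvd (pow_pos hp.pos _) h1))

/-- The primes are grouped by the rational primes below them. -/
theorem sum_absNorm_rpow_le {S : Finset (Ideal (𝓞 K))} (hS : ∀ q ∈ S, Prime q) {σ : ℝ}
    (hσ : 1 < σ) : ∑ q ∈ S, (Ideal.absNorm q : ℝ) ^ (-σ) ≤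
      Module.finrank ℚ K * ∑' m : ℕ, (m : ℝ) ^ (-σ) := by
  have hsum : Summable fun m : ℕ => (m : ℝ) ^ (-σ) := Real.summable_nat_rpow.mpr (by linarith)
  calc ∑ q ∈ S, (Ideal.absNorm q : ℝ) ^ (-σ) ≤ ∑ q ∈ S, (primeBelow q : ℝ) ^ (-σ) := by
        refine Finset.sum_le_sum fun q hq => ?_
        exact Real.rpow_le_rpow_of_nonpos (Nat.cast_pos.mpr (primeBelow_prime (hS q hq)).pos)
          (Nat.cast_le.mpr (primeBelow_le_absNorm (hS q hq))) (by linarith)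
    _ = ∑ p ∈ S.image primeBelow,
          ((S.filter fun q => primeBelow q = p).card : ℝ) * (p : ℝ) ^ (-σ) := by
        rw [← Finset.sum_fiberwise_of_maps_to (g := primeBelow) (t := S.image primeBelow)
          fun q hq => Finset.mem_image_of_mem _ hq]
        refine Finset.sum_congr rfl fun p _ => ?_
        rw [Finset.sum_congr rfl (g := fun _ => (p : ℝ) ^ (-σ)) fun q hq => by
          rw [(Finset.mem_filter.mp hq).2], Finset.sum_const, nsmul_eq_mul]
    _ ≤ ∑ p ∈ S.image primeBelow, (Module.finrank ℚ K : ℝ) * (p : ℝ) ^ (-σ) := by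
        refine Finset.sum_le_sum fun p _ => ?_
        have := card_primeBelow_fiber_le hS p
        gcongr
    _ ≤ Module.finrank ℚ K * ∑' m : ℕ, (m : ℝ) ^ (-σ) := by
        rw [← Finset.mul_sum]
        gcongr
        exact hsum.sum_le_tsum _ fun m _ => by positivity

variable (K) in
/-- A lower bound for `ζ_K` in its half-plane of convergence, depending only on the degree. -/
theorem one_le_exp_mul_norm_dedekindZeta {w : ℂ} (hw : 1 < w.re) :
    1 ≤ Real.exp (Module.finrank ℚ K * ∑' m : ℕ, (m : ℝ) ^ (-w.re)) * ‖dedekindZeta K w‖ := by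
  have h := (tendsto_zetaAway (K := K) hw).norm
  rw [norm_one] at h
  refine le_of_tendsto h (Filter.Eventually.of_forall fun N => ?_)
  have hS : ∀ q ∈ primesNormLe K N, Prime q := fun q hq => (mem_primesNormLe.mp hq).1
  rw [zetaAway_eq_prod hS hw, norm_mul, norm_prod]
  gcongr
  calc ∏ q ∈ primesNormLe K N, ‖1 - (Ideal.absNorm q : ℂ) ^ (-w)‖
      ≤ ∏ q ∈ primesNormLe K N, Real.exp ((Ideal.absNorm q : ℝ) ^ (-w.re)) := by
        refine Finset.prod_le_prod (fun _ _ => norm_nonneg _) fun q _ => ?_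
        refine (norm_sub_le _ _).trans ?_
        rw [norm_one, Complex.norm_natCast_cpow_of_re_ne_zero _
          (by rw [Complex.neg_re]; linarith), Complex.neg_re, add_comm]
        exact Real.add_one_le_exp _
    _ ≤ _ := by
        rw [← Real.exp_sum]
        exact Real.exp_le_exp.mpr (sum_absNorm_rpow_le hS hw)

end LowerBound

end DedekindNorthcott

namespace DedekindNorthcott

open NumberField InfinitePlace

/-! ### Finiteness -/

section Finiteness

/-- Number fields of bounded degree and bounded special value have bounded discriminant. -/
theorem exists_discr_bound {s : ℂ} (hs : s.re < 0) (B : ℝ) (D : ℕ) :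
    ∃ N : ℕ, ∀ (K : Type u) [Field K] [NumberField K], ‖dedekindSpecialValue K s‖ ≤ B →
      Module.finrank ℚ K ≤ D → |discr K| ≤ N := by
  have hw : 1 < (1 - s).re := by rw [Complex.sub_re, Complex.one_re]; linarith
  obtain ⟨⟨a₀, b₀⟩, -, hmin⟩ := (Finset.range (D + 1) ×ˢ Finset.range (D + 1)).exists_min_image
    (fun p => ‖meromorphicTrailingCoeffAt (gammaRatio p.1 p.2) s‖) ⟨(0, 0), by simp⟩
  set t := ‖meromorphicTrailingCoeffAt (gammaRatio a₀ b₀) s‖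
  have ht : 0 < t := norm_pos_iff.mpr (meromorphicTrailingCoeffAt_gammaRatio_ne_zero a₀ b₀ s)
  set Z := ∑' m : ℕ, (m : ℝ) ^ (-(1 - s).re)
  have hZ : 0 ≤ Z := tsum_nonneg fun m => by positivity
  refine ⟨⌈(B * Real.exp (D * Z) / t) ^ 2⌉₊, fun K _ _ hB hD => ?_⟩
  have hzeta := one_le_exp_mul_norm_dedekindZeta K hw
  have hexp : Real.exp (Module.finrank ℚ K * Z) ≤ Real.exp (D * Z) :=
    Real.exp_le_exp.mpr (mul_le_mul_of_nonneg_right (Nat.cast_le.mpr hD) hZ)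
  have h0 : dedekindZeta K (1 - s) ≠ 0 := by
    intro h
    rw [h, norm_zero, mul_zero] at hzeta
    linarith
  rw [norm_dedekindSpecialValue K hs h0] at hB
  have hplaces : nrRealPlaces K + 2 * nrComplexPlaces K = Module.finrank ℚ K :=
    card_add_two_mul_card_eq_rank K
  have hgamma := hmin (nrRealPlaces K, nrComplexPlaces K) (by
    simp only [Finset.mem_product, Finset.mem_range]
    omega)
  dsimp only at hgamma
  have hd1 : 1 ≤ √|(discr K : ℝ)| := by
    rw [Real.one_le_sqrt]
    exact_mod_cast Int.one_le_abs (discr_ne_zero K)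
  have hd : √|(discr K : ℝ)| ≤ √|(discr K : ℝ)| ^ (1 - 2 * s.re) :=
    Real.self_le_rpow_of_one_le hd1 (by linarith)
  have h1 : √|(discr K : ℝ)| * t ≤ B * Real.exp (D * Z) := by
    set d := √|(discr K : ℝ)|
    set z := ‖dedekindZeta K (1 - s)‖
    have hz : 0 ≤ z := norm_nonneg _
    calc d * t ≤ d * t * (Real.exp (D * Z) * z) :=
          le_mul_of_one_le_right (by positivity)
            (hzeta.trans (mul_le_mul_of_nonneg_right hexp hz))
      _ = d * t * z * Real.exp (D * Z) := by ring
      _ ≤ B * Real.exp (D * Z) := by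
          refine mul_le_mul_of_nonneg_right (le_trans ?_ hB) (Real.exp_pos _).le
          gcongr
  have h2 : √|(discr K : ℝ)| ≤ B * Real.exp (D * Z) / t := (le_div_iff₀ ht).mpr h1
  have h3 : |(discr K : ℝ)| ≤ (B * Real.exp (D * Z) / t) ^ 2 := by
    rw [← Real.sq_sqrt (abs_nonneg (discr K : ℝ))]
    gcongr
  have h4 := h3.trans (Nat.le_ceil _)
  exact_mod_cast h4

/-- A subfield of `ℂ` in the given isomorphism class. -/
noncomputable def complexModel (c : NumberFieldClass.{u}) :
    {F : IntermediateField ℚ ℂ // FiniteDimensional ℚ F} :=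
  ⟨((Classical.arbitrary (c.out.carrier →+* ℂ)).toRatAlgHom).fieldRange,
    ((AlgEquiv.ofInjectiveField
      (Classical.arbitrary (c.out.carrier →+* ℂ)).toRatAlgHom).toLinearEquiv).finiteDimensional⟩

/-- A number field is isomorphic to its complex model. -/
noncomputable def equivComplexModel (c : NumberFieldClass.{u}) :
    c.out.carrier ≃ₐ[ℚ] (complexModel c).1 :=
  AlgEquiv.ofInjectiveField (Classical.arbitrary (c.out.carrier →+* ℂ)).toRatAlgHom

/-- Number fields with the same complex model are isomorphic. -/
theorem complexModel_injective : Function.Injective complexModel.{u} := by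
  intro c d h
  rw [← Quotient.out_eq c, ← Quotient.out_eq d]
  refine Quotient.sound ⟨?_⟩
  have e : (complexModel c).1 ≃ₐ[ℚ] (complexModel d).1 :=
    IntermediateField.equivOfEq (congrArg Subtype.val h)
  exact (((equivComplexModel c).trans e).trans (equivComplexModel d).symm).toRingEquiv

/-- By Hermite's theorem, there are finitely many number fields of bounded discriminant up to
isomorphism. -/
theorem finite_numberFieldClass_of_discr_le (N : ℕ) :
    {c : NumberFieldClass.{u} | |discr c.out.carrier| ≤ N}.Finite := by
  refine Set.Finite.of_injOn (f := complexModel) (fun c hc => ?_) complexModel_injective.injOn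
    (NumberField.finite_of_discr_bdd ℂ N)
  have : NumberField (complexModel c).1 := @NumberField.mk _ _ inferInstance (complexModel c).2
  have h := discr_eq_discr_of_algEquiv c.out.carrier (equivComplexModel c)
  rw [Set.mem_ofPred_eq] at hc ⊢
  rwa [h] at hc

end Finiteness

end DedekindNorthcott

theorem theorem1p5 (s : ℂ) (hs : s.re < 0) :
    Northcott (fun K : NumberFieldClass.{u} => (dedekindHeight s K, numberFieldDegree K)) := by
  refine ⟨fun ⟨B, D⟩ => ?_⟩
  obtain ⟨N, hN⟩ := DedekindNorthcott.exists_discr_bound.{u} hs B D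
  refine (DedekindNorthcott.finite_numberFieldClass_of_discr_le N).subset fun c hc => ?_
  obtain ⟨h1, h2⟩ := Prod.mk_le_mk.mp hc
  rw [← Quotient.out_eq c] at h1 h2
  exact hN c.out.carrier h1 h2
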